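/- Let $\mathcal G_1,\mathcal G_2$ (orientable) and $\mathcal B_1,\mathcal B_2,\mathcal B_4$ (non-orientable) be closed flat 3-manifolds with fundamental groups $$\pi_1(\mathcal G_1)\cong\mathbb Z^3,$$ $$\pi_1(\mathcal G_2)=\langle x,y,z : xyx^{-1}y^{-1}=1,\ zxz^{-1}=x^{-1},\ zyz^{-1}=y^{-1}\rangle,$$ $$\pi_1(\mathcal B_1)=\langle x,y,z : xyx^{-1}y^{-1}=yzy^{-1}z^{-1}=1,\ zxz^{-1}=x^{-1}\rangle,$$ $$\pi_1(\mathcal B_2)=\langle x,y,z : xyx^{-1}y^{-1}=1,\ zxz^{-1}=x^{-1},\ zyz^{-1}=xy\rangle,$$ $$\pi_1(\mathcal B_4)=\langle x,y,z : yxy^{-1}=zxz^{-1}=x^{-1},\ zyz^{-1}=xy^{-1}\rangle.$$ For a positive integer $m$ put $$\sigma_1(m)=\sum_{ab=m}a,\qquad \chi(m)=\sum_{ab=m}a\,\sigma_1(b),\qquad \omega(m)=\sum_{ab=m}a\,\sigma_1(a),$$ the sums being over ordered pairs of positive integers, and let $\chi(q)=\omega(q)=0$ for positive rational $q\notin\mathbb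 Z$. For $H\in\{\mathcal G_1,\mathcal G_2,\mathcal B_1,\mathcal B_2,\mathcal B_4\}$ let $s_{H,\mathcal B_4}(n)$ be the number of subgroups of index $n$ in $\pi_1(\mathcal B_4)$ that are isomorphic to $\pi_1(H)$. Then every subgroup of finite index in $\pi_1(\mathcal B_4)$ is isomorphic to one of $\mathbb Z^3$, $\pi_1(\mathcal G_2)$, $\pi_1(\mathcal B_1)$, $\pi_1(\mathcal B_2)$, $\pi_1(\mathcal B_4)$. Moreover, for every integer $n\ge 1$ there are only finitely many subgroups of index $n$ in $\pi_1(\mathcal B_4)$, and \begin{align*} s_{\mathcal G_1,\mathcal B_4}(n)&=\omega\left(\tfrac n4\right),\\ s_{\mathcal G_2,\mathcal B_4}(n)&=\omega\left(\tfrac n2\right)-\omega\left(\tfrac n4\right),\\ s_{\mathcal B_1,\mathcal B_4}(n)&=2\chi\left(\tfrac n2\right)-2\chi\left(\tfrac n4\right),\\ s_{\mathcal B_2,\mathcal B_4}(n)&=4\chi\left(\tfrac n4\right)-4\chi\left(\tfrac n8\right),\\ s_{\mathcal B_4,\mathcal B_4}(n)&=\chi(n)-5\chi\left(\tfrac n2\right)+8\chi\left(\tfrac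 n4\right)-4\chi\left(\tfrac n8\right). \end{align*} -/

import Mathlib

open scoped ArithmeticFunction.sigma

/-- Generators of the presentations below. -/
inductive Gen
  | x
  | y
  | z

/-- The three generators as elements of the free group. -/
def gx : FreeGroup Gen := FreeGroup.of Gen.x

def gy : FreeGroup Gen := FreeGroup.of Gen.y

def gz : FreeGroup Gen := FreeGroup.of Gen.z

/-- `π₁(𝒢₁) ≅ ℤ³`. -/
abbrev PiG1 : Type := Multiplicative (Fin 3 → ℤ)

/-- `π₁(𝒢₂) = ⟨x, y, z : x y x⁻¹ y⁻¹ = 1, z x z⁻¹ = x⁻¹, z y z⁻¹ = y⁻¹⟩`. -/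
abbrev PiG2 : Type :=
  PresentedGroup ({gx * gy * gx⁻¹ * gy⁻¹, gz * gx * gz⁻¹ * (gx⁻¹)⁻¹,
    gz * gy * gz⁻¹ * (gy⁻¹)⁻¹} : Set (FreeGroup Gen))

/-- `π₁(ℬ₁) = ⟨x, y, z : x y x⁻¹ y⁻¹ = y z y⁻¹ z⁻¹ = 1, z x z⁻¹ = x⁻¹⟩`. -/
abbrev PiB1 : Type :=
  PresentedGroup ({gx * gy * gx⁻¹ * gy⁻¹, gy * gz * gy⁻¹ * gz⁻¹,
    gz * gx * gz⁻¹ * (gx⁻¹)⁻¹} : Set (FreeGroup Gen))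

/-- `π₁(ℬ₂) = ⟨x, y, z : x y x⁻¹ y⁻¹ = 1, z x z⁻¹ = x⁻¹, z y z⁻¹ = x y⟩`. -/
abbrev PiB2 : Type :=
  PresentedGroup ({gx * gy * gx⁻¹ * gy⁻¹, gz * gx * gz⁻¹ * (gx⁻¹)⁻¹,
    gz * gy * gz⁻¹ * (gx * gy)⁻¹} : Set (FreeGroup Gen))

/-- `π₁(ℬ₄) = ⟨x, y, z : y x y⁻¹ = z x z⁻¹ = x⁻¹, z y z⁻¹ = x y⁻¹⟩`. -/
abbrev PiB4 : Type :=
  PresentedGroup ({gy * gx * gy⁻¹ * (gx⁻¹)⁻¹, gz * gx * gz⁻¹ * (gx⁻¹)⁻¹,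
    gz * gy * gz⁻¹ * (gx * gy⁻¹)⁻¹} : Set (FreeGroup Gen))

/-- `s_{H,G}(n)`: the number of subgroups of index `n` in `G` that are isomorphic to `H`. -/
noncomputable def subgroupCount (H G : Type) [Group H] [Group G] (n : ℕ) : ℕ :=
  {Δ : Subgroup G | Δ.index = n ∧ Nonempty (Δ ≃* H)}.ncard

/-- `χ(n) = ∑_{ab=n} a σ₁(b)`, the sum being over ordered pairs of positive integers. -/
def chi (n : ℕ) : ℤ := ∑ p ∈ n.divisorsAntidiagonal, ((p.1 * σ 1 p.2 : ℕ) : ℤ)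

/-- `ω(n) = ∑_{ab=n} a σ₁(a)`, the sum being over ordered pairs of positive integers. -/
def omega (n : ℕ) : ℤ := ∑ p ∈ n.divisorsAntidiagonal, ((p.1 * σ 1 p.1 : ℕ) : ℤ)

/-- The value `f (n / k)`, understood as `0` when `n / k` is not an integer. -/
def atQuot (f : ℕ → ℤ) (n k : ℕ) : ℤ := if k ∣ n then f (n / k) else 0

/-! ### Normal forms in polycyclic groups. -/

section NormalForm

variable {G : Type*} [Group G]

/-! Every element of `PiB4` is uniquely `x ^ i * y ^ j * z ^ k`, so the group is `ℤ³` with a product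
twisted only by the parities of `j` and `k` (`B4Model`). As with Hermite normal forms, a subgroup of
finite index has an echelon basis X = ⟨a, 0, 0⟩, Y = ⟨s, b, 0⟩, Z = ⟨t, u, c⟩ (`exists_hasBasis`).
Its index is abc, and it determines a, b, c, s mod a, u mod b and, once u is fixed, t mod a
(`HasBasis.unique`). Conversely, such a triple is a basis of its closure as soon as Z Y Z⁻¹ = X ^ m
Y^{±1} for some m (`hasBasis_closure`), which is a congruence modulo a.

Parities then decide both the congruence and the isomorphism type. If b and u are even, s and t are
free, and the subgroup is `ℤ³` for c even and 𝒢₂ for c odd. If b is even and u odd, the condition is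
2s ≡ 0 mod a: s = 0 gives ℬ₁ and s = a/2 gives ℬ₂. If b is odd, u may be taken even; for c even the
condition is 2t ≡ 0, giving ℬ₁ or ℬ₂ in the same way, and for c odd it is 2(t - s) + 1 ≡ 0, which
forces a to be odd and gives ℬ₄ (`mem_family`).

The choices of (s, t) depend on a alone, those of u on b alone, and c is restricted at most by
parity. Hence each count is a Dirichlet convolution of three factors (`basisFamily_card`), built
from n², n, 1 and the indicator δ of 2; here ω = n² * n * 1 and χ = n * n * 1, and parity
restrictions become polynomials in δ. The five groups have different numbers of homomorphisms to a
cyclic group of order six, so each family is exactly one isomorphism class (`setOf_index_eq`). -/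

theorem conj_zpow_mem {K : Subgroup G} {x g : G} (h : g * x * g⁻¹ ∈ K) (i : ℤ) :
    g * x ^ i * g⁻¹ ∈ K := by
  rw [← conj_zpow]
  exact K.zpow_mem h i

/-- Left multiplication by a generator preserves the shape: moving `y` or `y⁻¹` past a power of `x`
leaves a power of `x`. -/
theorem exists_zpow_mul_zpow_of_mem_closure {x y : G}
    (h : y * x * y⁻¹ ∈ Subgroup.zpowers x) (h' : y⁻¹ * x * y ∈ Subgroup.zpowers x) {g : G}
    (hg : g ∈ Subgroup.closure {x, y}) : ∃ i j : ℤ, g = x ^ i * y ^ j := by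
  induction hg using Subgroup.closure_induction_left with
  | one => exact ⟨0, 0, by simp⟩
  | mul_left u hu v hv ih =>
    obtain ⟨i, j, rfl⟩ := ih
    rcases hu with rfl | rfl
    · exact ⟨i + 1, j, by group⟩
    · obtain ⟨l, hl⟩ := Subgroup.mem_zpowers_iff.1 (conj_zpow_mem h i)
      exact ⟨l, j + 1, by rw [hl]; group⟩
  | inv_mul_cancel u hu v hv ih =>
    obtain ⟨i, j, rfl⟩ := ih
    rcases hu with rfl | rfl
    · exact ⟨i - 1, j, by group⟩
    · obtain ⟨l, hl⟩ := Subgroup.mem_zpowers_iff.1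
        (conj_zpow_mem (g := u⁻¹) (by simpa using h') i)
      exact ⟨l, j - 1, by rw [hl]; group⟩

/-- A polycyclic normal form: if `⟨x⟩` is normalized by `y` and `z`, and `⟨x, y⟩` by `z`, then
every element of `⟨x, y, z⟩` has the form `x ^ i * y ^ j * z ^ k`. -/
theorem exists_zpow_mul_zpow_mul_zpow_of_mem_closure {x y z : G}
    (hyx : y * x * y⁻¹ ∈ Subgroup.zpowers x) (hyx' : y⁻¹ * x * y ∈ Subgroup.zpowers x)
    (hzx : z * x * z⁻¹ ∈ Subgroup.zpowers x) (hzx' : z⁻¹ * x * z ∈ Subgroup.zpowers x)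
    (hzy : z * y * z⁻¹ ∈ Subgroup.closure {x, y})
    (hzy' : z⁻¹ * y * z ∈ Subgroup.closure {x, y}) {g : G}
    (hg : g ∈ Subgroup.closure {x, y, z}) : ∃ i j k : ℤ, g = x ^ i * y ^ j * z ^ k := by
  have hx : Subgroup.zpowers x ≤ Subgroup.closure {x, y} := by
    rw [Subgroup.zpowers_le]; exact Subgroup.subset_closure (by simp)
  have conj : ∀ w : G, w * x * w⁻¹ ∈ Subgroup.zpowers x →
      w * y * w⁻¹ ∈ Subgroup.closure {x, y} → ∀ i j : ℤ, ∃ i' j' : ℤ,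
        w * (x ^ i * y ^ j) = x ^ i' * y ^ j' * w := by
    intro w h1 h2 i j
    have h3 := (Subgroup.closure {x, y}).mul_mem (conj_zpow_mem (hx h1) i) (conj_zpow_mem h2 j)
    obtain ⟨i', j', h⟩ := exists_zpow_mul_zpow_of_mem_closure hyx hyx' h3
    exact ⟨i', j', by rw [← h]; group⟩
  induction hg using Subgroup.closure_induction_left with
  | one => exact ⟨0, 0, 0, by simp⟩
  | mul_left u hu v hv ih =>
    obtain ⟨i, j, k, rfl⟩ := ih
    rcases hu with rfl | rfl | rfl
    · exact ⟨i + 1, j, k, by group⟩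
    · obtain ⟨l, hl⟩ := Subgroup.mem_zpowers_iff.1 (conj_zpow_mem hyx i)
      exact ⟨l, j + 1, k, by rw [hl]; group⟩
    · obtain ⟨i', j', h⟩ := conj u hzx hzy i j
      exact ⟨i', j', k + 1, by rw [← mul_assoc, h]; group⟩
  | inv_mul_cancel u hu v hv ih =>
    obtain ⟨i, j, k, rfl⟩ := ih
    rcases hu with rfl | rfl | rfl
    · exact ⟨i - 1, j, k, by group⟩
    · obtain ⟨l, hl⟩ := Subgroup.mem_zpowers_iff.1
        (conj_zpow_mem (g := u⁻¹) (by simpa using hyx') i)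
      exact ⟨l, j - 1, k, by rw [hl]; group⟩
    · obtain ⟨i', j', h⟩ := conj u⁻¹ (by simpa using hzx') (by simpa using hzy') i j
      exact ⟨i', j', k - 1, by rw [← mul_assoc, h]; group⟩

/-- The normal form `x ^ i * y ^ j * z ^ k` represents the identity only trivially. -/
def ZPowIndependent (x y z : G) : Prop :=
  ∀ i j k : ℤ, x ^ i * y ^ j * z ^ k = 1 → i = 0 ∧ j = 0 ∧ k = 0

end NormalForm

/-! ### Recognizing presented groups from independent generators. -/

section Presented

variable {G : Type*} [Group G]

/-- The assignment of the three generators. -/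
def genFun (x y z : G) : Gen → G
  | Gen.x => x
  | Gen.y => y
  | Gen.z => z

@[simp] theorem lift_gx (x y z : G) : FreeGroup.lift (genFun x y z) gx = x := by
  simp [gx, genFun]

@[simp] theorem lift_gy (x y z : G) : FreeGroup.lift (genFun x y z) gy = y := by
  simp [gy, genFun]

@[simp] theorem lift_gz (x y z : G) : FreeGroup.lift (genFun x y z) gz = z := by
  simp [gz, genFun]

theorem presentedGroup_mem_closure (rels : Set (FreeGroup Gen)) (g : PresentedGroup rels) :
    g ∈ Subgroup.closure {PresentedGroup.mk rels gx, PresentedGroup.mk rels gy,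
      PresentedGroup.mk rels gz} := by
  have h : ({PresentedGroup.mk rels gx, PresentedGroup.mk rels gy,
      PresentedGroup.mk rels gz} : Set (PresentedGroup rels)) =
      Set.range (PresentedGroup.of (rels := rels)) := by
    ext g
    constructor
    · rintro (rfl | rfl | rfl)
      exacts [⟨Gen.x, rfl⟩, ⟨Gen.y, rfl⟩, ⟨Gen.z, rfl⟩]
    · rintro ⟨_ | _ | _, rfl⟩
      exacts [Or.inl rfl, Or.inr (Or.inl rfl), Or.inr (Or.inr rfl)]
  rw [h, PresentedGroup.closure_range_of]
  trivial

/-- Independent elements satisfying the relations of a presentation with normal forms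
generate a group with this presentation. -/
theorem nonempty_closure_mulEquiv_presentedGroup {rels : Set (FreeGroup Gen)} {x y z : G}
    (hrel : ∀ r ∈ rels, FreeGroup.lift (genFun x y z) r = 1)
    (hnf : ∀ g : PresentedGroup rels, ∃ i j k : ℤ, g = PresentedGroup.mk rels gx ^ i *
      PresentedGroup.mk rels gy ^ j * PresentedGroup.mk rels gz ^ k)
    (hind : ZPowIndependent x y z) :
    Nonempty (Subgroup.closure {x, y, z} ≃* PresentedGroup rels) := by
  let φ : PresentedGroup rels →* G := PresentedGroup.toGroup hrel
  have hφ : ∀ w, φ (PresentedGroup.mk rels w) = FreeGroup.lift (genFun x y z) w := fun w => rfl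
  have hinj : Function.Injective φ := by
    rw [injective_iff_map_eq_one]
    intro g hg
    -- Only existence of normal forms is needed in the presented group; independence of the images
    -- makes the kernel trivial.
    obtain ⟨i, j, k, rfl⟩ := hnf g
    simp only [map_mul, map_zpow, hφ, lift_gx, lift_gy, lift_gz] at hg
    obtain ⟨rfl, rfl, rfl⟩ := hind i j k hg
    simp
  have hrange : φ.range = Subgroup.closure {x, y, z} := by
    apply le_antisymm
    · rintro _ ⟨g, rfl⟩
      obtain ⟨i, j, k, rfl⟩ := hnf g
      simp only [map_mul, map_zpow, hφ, lift_gx, lift_gy, lift_gz]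
      refine mul_mem (mul_mem ?_ ?_) ?_ <;>
        exact zpow_mem (Subgroup.subset_closure (by simp)) _
    · rw [Subgroup.closure_le]
      rintro _ (rfl | rfl | rfl)
      exacts [⟨PresentedGroup.mk rels gx, by simp [hφ]⟩,
        ⟨PresentedGroup.mk rels gy, by simp [hφ]⟩, ⟨PresentedGroup.mk rels gz, by simp [hφ]⟩]
  exact ⟨(MulEquiv.subgroupCongr hrange.symm).trans (MonoidHom.ofInjective hinj).symm⟩

theorem mem_zpowers_of_eq {x g : G} (h : g = x) : g ∈ Subgroup.zpowers x :=
  h ▸ Subgroup.mem_zpowers x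

theorem mem_zpowers_of_eq_inv {x g : G} (h : g = x⁻¹) : g ∈ Subgroup.zpowers x :=
  h ▸ inv_mem (Subgroup.mem_zpowers x)

theorem zpow_mul_zpow_mem_closure_pair {x y g : G} (i j : ℤ) (h : g = x ^ i * y ^ j) :
    g ∈ Subgroup.closure {x, y} :=
  h ▸ mul_mem (zpow_mem (Subgroup.subset_closure (by simp)) _)
    (zpow_mem (Subgroup.subset_closure (by simp)) _)

theorem inv_conj_of_conj_eq_inv {x z : G} (h : z * x * z⁻¹ = x⁻¹) : z⁻¹ * x * z = x⁻¹ := by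
  have h1 : z * x⁻¹ * z⁻¹ = x := by
    rw [← conj_inv, h, inv_inv]
  calc z⁻¹ * x * z = z⁻¹ * (z * x⁻¹ * z⁻¹) * z := by rw [h1]
    _ = x⁻¹ := by group

theorem inv_conj_of_conj_eq {x y z : G} (h : z * x * z⁻¹ = y) : z⁻¹ * y * z = x := by
  rw [← h]; group

theorem mk_eq_one {rels : Set (FreeGroup Gen)} {r : FreeGroup Gen} (h : r ∈ rels) :
    PresentedGroup.mk rels r = 1 :=
  PresentedGroup.one_of_mem h

theorem piG2_normalForm (g : PiG2) : ∃ i j k : ℤ, g = PresentedGroup.mk _ gx ^ i *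
      PresentedGroup.mk _ gy ^ j * PresentedGroup.mk _ gz ^ k := by
  have h1 := mk_eq_one (rels := {gx * gy * gx⁻¹ * gy⁻¹, gz * gx * gz⁻¹ * (gx⁻¹)⁻¹,
    gz * gy * gz⁻¹ * (gy⁻¹)⁻¹}) (r := gx * gy * gx⁻¹ * gy⁻¹) (by simp)
  have h2 := mk_eq_one (rels := {gx * gy * gx⁻¹ * gy⁻¹, gz * gx * gz⁻¹ * (gx⁻¹)⁻¹,
    gz * gy * gz⁻¹ * (gy⁻¹)⁻¹}) (r := gz * gx * gz⁻¹ * (gx⁻¹)⁻¹) (by simp)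
  have h3 := mk_eq_one (rels := {gx * gy * gx⁻¹ * gy⁻¹, gz * gx * gz⁻¹ * (gx⁻¹)⁻¹,
    gz * gy * gz⁻¹ * (gy⁻¹)⁻¹}) (r := gz * gy * gz⁻¹ * (gy⁻¹)⁻¹) (by simp)
  have hg := presentedGroup_mem_closure _ g
  simp only [map_mul, map_inv] at h1 h2 h3
  generalize PresentedGroup.mk _ gx = x at *
  generalize PresentedGroup.mk _ gy = y at *
  generalize PresentedGroup.mk _ gz = z at *
  rw [mul_inv_eq_one] at h1 h2 h3
  have h1' : y * x * y⁻¹ = x := by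
    rw [mul_inv_eq_iff_eq_mul] at h1 ⊢; exact h1.symm
  exact exists_zpow_mul_zpow_mul_zpow_of_mem_closure (mem_zpowers_of_eq h1')
    (mem_zpowers_of_eq (inv_conj_of_conj_eq h1')) (mem_zpowers_of_eq_inv h2)
    (mem_zpowers_of_eq_inv (inv_conj_of_conj_eq_inv h2))
    (zpow_mul_zpow_mem_closure_pair 0 (-1) (by simpa using h3))
    (zpow_mul_zpow_mem_closure_pair 0 (-1) (by simpa using inv_conj_of_conj_eq_inv h3)) hg

theorem piB1_normalForm (g : PiB1) : ∃ i j k : ℤ, g = PresentedGroup.mk _ gx ^ i *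
      PresentedGroup.mk _ gy ^ j * PresentedGroup.mk _ gz ^ k := by
  have h1 := mk_eq_one (rels := {gx * gy * gx⁻¹ * gy⁻¹, gy * gz * gy⁻¹ * gz⁻¹,
    gz * gx * gz⁻¹ * (gx⁻¹)⁻¹}) (r := gx * gy * gx⁻¹ * gy⁻¹) (by simp)
  have h2 := mk_eq_one (rels := {gx * gy * gx⁻¹ * gy⁻¹, gy * gz * gy⁻¹ * gz⁻¹,
    gz * gx * gz⁻¹ * (gx⁻¹)⁻¹}) (r := gz * gx * gz⁻¹ * (gx⁻¹)⁻¹) (by simp)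
  have h3 := mk_eq_one (rels := {gx * gy * gx⁻¹ * gy⁻¹, gy * gz * gy⁻¹ * gz⁻¹,
    gz * gx * gz⁻¹ * (gx⁻¹)⁻¹}) (r := gy * gz * gy⁻¹ * gz⁻¹) (by simp)
  have hg := presentedGroup_mem_closure _ g
  simp only [map_mul, map_inv] at h1 h2 h3
  generalize PresentedGroup.mk _ gx = x at *
  generalize PresentedGroup.mk _ gy = y at *
  generalize PresentedGroup.mk _ gz = z at *
  rw [mul_inv_eq_one] at h1 h2 h3
  have h1' : y * x * y⁻¹ = x := by
    rw [mul_inv_eq_iff_eq_mul] at h1 ⊢; exact h1.symm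
  have h3' : z * y * z⁻¹ = y := by
    rw [mul_inv_eq_iff_eq_mul] at h3 ⊢; exact h3.symm
  exact exists_zpow_mul_zpow_mul_zpow_of_mem_closure (mem_zpowers_of_eq h1')
    (mem_zpowers_of_eq (inv_conj_of_conj_eq h1')) (mem_zpowers_of_eq_inv h2)
    (mem_zpowers_of_eq_inv (inv_conj_of_conj_eq_inv h2))
    (zpow_mul_zpow_mem_closure_pair 0 1 (by simpa using h3'))
    (zpow_mul_zpow_mem_closure_pair 0 1 (by simpa using inv_conj_of_conj_eq h3')) hg

theorem piB2_normalForm (g : PiB2) : ∃ i j k : ℤ, g = PresentedGroup.mk _ gx ^ i *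
      PresentedGroup.mk _ gy ^ j * PresentedGroup.mk _ gz ^ k := by
  have h1 := mk_eq_one (rels := {gx * gy * gx⁻¹ * gy⁻¹, gz * gx * gz⁻¹ * (gx⁻¹)⁻¹,
    gz * gy * gz⁻¹ * (gx * gy)⁻¹}) (r := gx * gy * gx⁻¹ * gy⁻¹) (by simp)
  have h2 := mk_eq_one (rels := {gx * gy * gx⁻¹ * gy⁻¹, gz * gx * gz⁻¹ * (gx⁻¹)⁻¹,
    gz * gy * gz⁻¹ * (gx * gy)⁻¹}) (r := gz * gx * gz⁻¹ * (gx⁻¹)⁻¹) (by simp)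
  have h3 := mk_eq_one (rels := {gx * gy * gx⁻¹ * gy⁻¹, gz * gx * gz⁻¹ * (gx⁻¹)⁻¹,
    gz * gy * gz⁻¹ * (gx * gy)⁻¹}) (r := gz * gy * gz⁻¹ * (gx * gy)⁻¹) (by simp)
  have hg := presentedGroup_mem_closure _ g
  simp only [map_mul, map_inv] at h1 h2 h3
  generalize PresentedGroup.mk _ gx = x at *
  generalize PresentedGroup.mk _ gy = y at *
  generalize PresentedGroup.mk _ gz = z at *
  rw [mul_inv_eq_one] at h1 h2 h3
  have h1' : y * x * y⁻¹ = x := by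
    rw [mul_inv_eq_iff_eq_mul] at h1 ⊢; exact h1.symm
  have h2' := inv_conj_of_conj_eq_inv h2
  -- Conjugating `x * y` back by `z` gives `y`; dividing off the conjugate `x⁻¹` of `x` isolates
  -- that of `y`.
  have h3' : z⁻¹ * y * z = x * y := by
    calc z⁻¹ * y * z = (z⁻¹ * x * z)⁻¹ * (z⁻¹ * (x * y) * z) := by group
      _ = x * y := by rw [h2', inv_conj_of_conj_eq h3]; group
  exact exists_zpow_mul_zpow_mul_zpow_of_mem_closure (mem_zpowers_of_eq h1')
    (mem_zpowers_of_eq (inv_conj_of_conj_eq h1')) (mem_zpowers_of_eq_inv h2)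
    (mem_zpowers_of_eq_inv h2')
    (zpow_mul_zpow_mem_closure_pair 1 1 (by simpa using h3))
    (zpow_mul_zpow_mem_closure_pair 1 1 (by simpa using h3')) hg

theorem piB4_normalForm (g : PiB4) : ∃ i j k : ℤ, g = PresentedGroup.mk _ gx ^ i *
      PresentedGroup.mk _ gy ^ j * PresentedGroup.mk _ gz ^ k := by
  have h1 := mk_eq_one (rels := {gy * gx * gy⁻¹ * (gx⁻¹)⁻¹, gz * gx * gz⁻¹ * (gx⁻¹)⁻¹,
    gz * gy * gz⁻¹ * (gx * gy⁻¹)⁻¹}) (r := gy * gx * gy⁻¹ * (gx⁻¹)⁻¹) (by simp)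
  have h2 := mk_eq_one (rels := {gy * gx * gy⁻¹ * (gx⁻¹)⁻¹, gz * gx * gz⁻¹ * (gx⁻¹)⁻¹,
    gz * gy * gz⁻¹ * (gx * gy⁻¹)⁻¹}) (r := gz * gx * gz⁻¹ * (gx⁻¹)⁻¹) (by simp)
  have h3 := mk_eq_one (rels := {gy * gx * gy⁻¹ * (gx⁻¹)⁻¹, gz * gx * gz⁻¹ * (gx⁻¹)⁻¹,
    gz * gy * gz⁻¹ * (gx * gy⁻¹)⁻¹}) (r := gz * gy * gz⁻¹ * (gx * gy⁻¹)⁻¹) (by simp)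
  have hg := presentedGroup_mem_closure _ g
  simp only [map_mul, map_inv] at h1 h2 h3
  generalize PresentedGroup.mk _ gx = x at *
  generalize PresentedGroup.mk _ gy = y at *
  generalize PresentedGroup.mk _ gz = z at *
  rw [mul_inv_eq_one] at h1 h2 h3
  have h2' := inv_conj_of_conj_eq_inv h2
  have h3' : z⁻¹ * y * z = y⁻¹ * x⁻¹ := by
    calc z⁻¹ * y * z = (z⁻¹ * (x * y⁻¹) * z)⁻¹ * (z⁻¹ * x * z) := by group
      _ = y⁻¹ * x⁻¹ := by rw [h2', ← h3]; group
  exact exists_zpow_mul_zpow_mul_zpow_of_mem_closure (mem_zpowers_of_eq_inv h1)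
    (mem_zpowers_of_eq_inv (inv_conj_of_conj_eq_inv h1)) (mem_zpowers_of_eq_inv h2)
    (mem_zpowers_of_eq_inv h2')
    (zpow_mul_zpow_mem_closure_pair 1 (-1) (by simpa using h3))
    (h3' ▸ mul_mem (inv_mem (Subgroup.subset_closure (by simp)))
      (inv_mem (Subgroup.subset_closure (by simp)))) hg

/-- `PiG1` is not given by a presentation, so the homomorphism is written in coordinates:
commutation makes it multiplicative, independence makes it injective. -/
theorem nonempty_closure_mulEquiv_piG1 {x y z : G} (hxy : x * y = y * x) (hxz : x * z = z * x)
    (hyz : y * z = z * y) (hind : ZPowIndependent x y z) :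
    Nonempty (Subgroup.closure {x, y, z} ≃* PiG1) := by
  let φ : PiG1 →* G := MonoidHom.mk'
    (fun v => x ^ (v.toAdd 0) * y ^ (v.toAdd 1) * z ^ (v.toAdd 2)) (by
      intro v w
      have hxy' : Commute x y := hxy
      have hxz' : Commute x z := hxz
      have hyz' : Commute y z := hyz
      simp only [toAdd_mul, Pi.add_apply, zpow_add]
      generalize v.toAdd 0 = a, v.toAdd 1 = b, v.toAdd 2 = c, w.toAdd 0 = a',
        w.toAdd 1 = b', w.toAdd 2 = c'
      have e1 := (hxy'.zpow_zpow a' b).eq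
      have e2 := (hxz'.zpow_zpow a' c).eq
      have e3 := (hyz'.zpow_zpow b' c).eq
      calc x ^ a * x ^ a' * (y ^ b * y ^ b') * (z ^ c * z ^ c')
          = x ^ a * (x ^ a' * y ^ b) * (y ^ b' * z ^ c) * z ^ c' := by group
        _ = x ^ a * y ^ b * (x ^ a' * z ^ c) * y ^ b' * z ^ c' := by rw [e1, e3]; group
        _ = _ := by rw [e2]; group)
  have hφ : ∀ v : PiG1, φ v = x ^ (v.toAdd 0) * y ^ (v.toAdd 1) * z ^ (v.toAdd 2) :=
    fun v => rfl
  have hinj : Function.Injective φ := by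
    rw [injective_iff_map_eq_one]
    intro g hg
    obtain ⟨h0, h1, h2⟩ := hind _ _ _ hg
    apply Multiplicative.toAdd.injective
    funext i
    fin_cases i
    exacts [h0, h1, h2]
  have hrange : φ.range = Subgroup.closure {x, y, z} := by
    apply le_antisymm
    · rintro _ ⟨g, rfl⟩
      rw [hφ]
      refine mul_mem (mul_mem ?_ ?_) ?_ <;>
        exact zpow_mem (Subgroup.subset_closure (by simp)) _
    · rw [Subgroup.closure_le]
      rintro _ (rfl | rfl | rfl)
      exacts [⟨Multiplicative.ofAdd ![1, 0, 0], by simp [hφ]⟩,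
        ⟨Multiplicative.ofAdd ![0, 1, 0], by simp [hφ]⟩,
        ⟨Multiplicative.ofAdd ![0, 0, 1], by simp [hφ]⟩]
  exact ⟨(MulEquiv.subgroupCongr hrange.symm).trans (MonoidHom.ofInjective hinj).symm⟩

theorem nonempty_closure_mulEquiv_piG2 {x y z : G} (h1 : x * y = y * x)
    (h2 : z * x * z⁻¹ = x⁻¹) (h3 : z * y * z⁻¹ = y⁻¹) (hind : ZPowIndependent x y z) :
    Nonempty (Subgroup.closure {x, y, z} ≃* PiG2) := by
  refine nonempty_closure_mulEquiv_presentedGroup ?_ piG2_normalForm hind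
  rintro r (rfl | rfl | rfl) <;> simp [h1, h2, h3]

theorem nonempty_closure_mulEquiv_piB1 {x y z : G} (h1 : x * y = y * x)
    (h2 : y * z = z * y) (h3 : z * x * z⁻¹ = x⁻¹) (hind : ZPowIndependent x y z) :
    Nonempty (Subgroup.closure {x, y, z} ≃* PiB1) := by
  refine nonempty_closure_mulEquiv_presentedGroup ?_ piB1_normalForm hind
  rintro r (rfl | rfl | rfl) <;> simp [h1, h2, h3]

theorem nonempty_closure_mulEquiv_piB2 {x y z : G} (h1 : x * y = y * x)
    (h2 : z * x * z⁻¹ = x⁻¹) (h3 : z * y * z⁻¹ = x * y) (hind : ZPowIndependent x y z) :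
    Nonempty (Subgroup.closure {x, y, z} ≃* PiB2) := by
  refine nonempty_closure_mulEquiv_presentedGroup ?_ piB2_normalForm hind
  rintro r (rfl | rfl | rfl)
  · simp [h1]
  · simp [h2]
  · simp only [map_mul, map_inv, lift_gx, lift_gy, lift_gz, h3, mul_inv_cancel]

theorem nonempty_closure_mulEquiv_piB4 {x y z : G} (h1 : y * x * y⁻¹ = x⁻¹)
    (h2 : z * x * z⁻¹ = x⁻¹) (h3 : z * y * z⁻¹ = x * y⁻¹) (hind : ZPowIndependent x y z) :
    Nonempty (Subgroup.closure {x, y, z} ≃* PiB4) := by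
  refine nonempty_closure_mulEquiv_presentedGroup ?_ piB4_normalForm hind
  rintro r (rfl | rfl | rfl) <;> simp [h1, h2, h3]

/-- Homomorphisms from a presented group are solutions of the relations. -/
def presentedGroupHomEquiv (rels : Set (FreeGroup Gen)) :
    (PresentedGroup rels →* G) ≃
      {p : G × G × G // ∀ r ∈ rels, FreeGroup.lift (genFun p.1 p.2.1 p.2.2) r = 1} where
  toFun φ := ⟨(φ (PresentedGroup.mk rels gx), φ (PresentedGroup.mk rels gy),
    φ (PresentedGroup.mk rels gz)), by
      intro r hr
      have : FreeGroup.lift (genFun (φ (PresentedGroup.mk rels gx))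
          (φ (PresentedGroup.mk rels gy)) (φ (PresentedGroup.mk rels gz))) =
          φ.comp (PresentedGroup.mk rels) := by
        ext (_ | _ | _) <;> simp [genFun, gx, gy, gz]
      rw [this, MonoidHom.comp_apply, mk_eq_one hr, map_one]⟩
  invFun p := PresentedGroup.toGroup p.2
  left_inv φ := by
    ext (_ | _ | _) <;> simp [genFun, gx, gy, gz] <;> rfl
  right_inv p := by
    ext
    exacts [lift_gx _ _ _, lift_gy _ _ _, lift_gz _ _ _]

end Presented

/-! ### Separating the five groups by homomorphism counts. -/

section Distinguish

/-- The number of homomorphisms to a cyclic group of order six. -/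
noncomputable def homCount (G : Type*) [Group G] : ℕ := Nat.card (G →* Multiplicative (ZMod 6))

theorem homCount_congr {G H : Type*} [Group G] [Group H] (e : G ≃* H) :
    homCount G = homCount H :=
  Nat.card_congr (MulEquiv.monoidHomCongrLeftEquiv e)

theorem homCount_presentedGroup (rels : Set (FreeGroup Gen))
    (P : ZMod 6 → ZMod 6 → ZMod 6 → Prop) [∀ a b c, Decidable (P a b c)]
    (h : ∀ x y z : Multiplicative (ZMod 6),
      (∀ r ∈ rels, FreeGroup.lift (genFun x y z) r = 1) ↔ P x.toAdd y.toAdd z.toAdd) :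
    homCount (PresentedGroup rels) =
      Fintype.card {p : ZMod 6 × ZMod 6 × ZMod 6 // P p.1 p.2.1 p.2.2} := by
  rw [homCount, Nat.card_congr (presentedGroupHomEquiv rels), ← Nat.card_eq_fintype_card]
  exact Nat.card_congr (Equiv.subtypeEquiv (Multiplicative.toAdd.prodCongr
    (Multiplicative.toAdd.prodCongr Multiplicative.toAdd)) (fun p => h p.1 p.2.1 p.2.2))

/-- The counts depend on abelianizations only. These are ℤ³, (ℤ/2)² × ℤ, ℤ/2 × ℤ², ℤ² and ℤ/4 × ℤ
for 𝒢₁, 𝒢₂, ℬ₁, ℬ₂ and ℬ₄. The 3-part of ℤ/6 sees the rank, and the 2-part separates 𝒢₂ from ℬ₄ and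
ℬ₁ from ℬ₂. -/
theorem homCount_piG1 : homCount PiG1 = 216 := by
  have e : (PiG1 →* Multiplicative (ZMod 6)) ≃ (Fin 3 → ZMod 6) :=
    (AddMonoidHom.toMultiplicative.symm.trans (addMonoidHomLequivInt ℤ).toEquiv).trans
      ((Pi.basisFun ℤ (Fin 3)).constr ℤ).symm.toEquiv
  rw [homCount, Nat.card_congr e]
  simp

theorem homCount_piG2 : homCount PiG2 = 24 := by
  refine (homCount_presentedGroup _ (fun a b _ => a + a = 0 ∧ b + b = 0) ?_).trans
    (by decide +kernel)
  intro x y z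
  simp only [Set.mem_insert_iff, Set.mem_singleton_iff, forall_eq_or_imp, forall_eq, map_mul,
    map_inv, lift_gx, lift_gy, lift_gz]
  revert x y z
  decide +kernel

theorem homCount_piB1 : homCount PiB1 = 72 := by
  refine (homCount_presentedGroup _ (fun a _ _ => a + a = 0) ?_).trans
    (by decide +kernel)
  intro x y z
  simp only [Set.mem_insert_iff, Set.mem_singleton_iff, forall_eq_or_imp, forall_eq, map_mul,
    map_inv, lift_gx, lift_gy, lift_gz]
  revert x y z
  decide +kernel

theorem homCount_piB2 : homCount PiB2 = 36 := by
  refine (homCount_presentedGroup _ (fun a _ _ => a = 0) ?_).trans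
    (by decide +kernel)
  intro x y z
  simp only [Set.mem_insert_iff, Set.mem_singleton_iff, forall_eq_or_imp, forall_eq, map_mul,
    map_inv, lift_gx, lift_gy, lift_gz]
  revert x y z
  decide +kernel

theorem homCount_piB4 : homCount PiB4 = 12 := by
  refine (homCount_presentedGroup _ (fun a b _ => a + a = 0 ∧ b + b = a) ?_).trans
    (by decide +kernel)
  intro x y z
  simp only [Set.mem_insert_iff, Set.mem_singleton_iff, forall_eq_or_imp, forall_eq, map_mul,
    map_inv, lift_gx, lift_gy, lift_gz]
  revert x y z
  decide +kernel

end Distinguish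

/-! ### The coordinate model of the group. -/

/-- The sign `(-1) ^ n`. -/
def zsgn (n : ℤ) : ℤ := 1 - 2 * (n % 2)

/-- Writing the parity of a sum as a polynomial in parities turns identities in the model into
polynomial ones once all parities are fixed. -/
theorem emod_two_add (m n : ℤ) : (m + n) % 2 = m % 2 + n % 2 - 2 * (m % 2) * (n % 2) := by
  rcases Int.emod_two_eq_zero_or_one m with h | h <;>
    rcases Int.emod_two_eq_zero_or_one n with h' | h' <;> rw [h, h'] <;> omega

theorem emod_two_zsgn_mul (m n : ℤ) : (zsgn m * n) % 2 = n % 2 := by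
  rcases Int.emod_two_eq_zero_or_one m with h | h <;> simp [zsgn, h]

theorem emod_two_neg (n : ℤ) : (-n) % 2 = n % 2 := by omega

/-- The group `π₁(ℬ₄)` in coordinates: `⟨i, j, k⟩` stands for `x ^ i * y ^ j * z ^ k`. -/
@[ext]
structure B4Model where
  i : ℤ
  j : ℤ
  k : ℤ

namespace B4Model

/-- Both y and z invert x, and (x y⁻¹)² = y⁻², so z yʲ z⁻¹ = x^(j mod 2) y⁻ʲ while z² centralizes y.
Moving z ^ g.k past y ^ h.j thus creates an x exactly when both exponents are odd, and moving this x
to the left past y ^ g.j gives it the sign `zsgn g.j`. -/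
instance : Mul B4Model where
  mul g h := ⟨g.i + zsgn (g.j + g.k) * h.i + zsgn g.j * ((g.k % 2) * (h.j % 2)),
    g.j + zsgn g.k * h.j, g.k + h.k⟩

instance : One B4Model where
  one := ⟨0, 0, 0⟩

instance : Inv B4Model where
  inv g := ⟨-zsgn (g.j + g.k) * g.i - zsgn g.k * ((g.k % 2) * (g.j % 2)), -zsgn g.k * g.j, -g.k⟩

theorem mul_def (g h : B4Model) :
    g * h = ⟨g.i + zsgn (g.j + g.k) * h.i + zsgn g.j * ((g.k % 2) * (h.j % 2)),
      g.j + zsgn g.k * h.j, g.k + h.k⟩ := rfl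

theorem one_def : (1 : B4Model) = ⟨0, 0, 0⟩ := rfl

theorem inv_def (g : B4Model) :
    g⁻¹ = ⟨-zsgn (g.j + g.k) * g.i - zsgn g.k * ((g.k % 2) * (g.j % 2)),
      -zsgn g.k * g.j, -g.k⟩ := rfl

instance : Group B4Model :=
  Group.ofLeftAxioms
    (by
      intro a b c
      have h1 : ∀ m n : ℤ, (m + zsgn n * b.j) % 2 = (m + b.j) % 2 := by
        intro m n; rw [emod_two_add, emod_two_zsgn_mul, ← emod_two_add]
      have h2 : ∀ m n : ℤ, (m + zsgn n * c.j) % 2 = (m + c.j) % 2 := by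
        intro m n; rw [emod_two_add, emod_two_zsgn_mul, ← emod_two_add]
      ext
      · simp only [mul_def, zsgn] at *
        simp only [emod_two_add, h1, h2]
        -- The first coordinate depends on these exponents through their parities only; in each
        -- parity case the identity is linear.
        rcases Int.emod_two_eq_zero_or_one a.j with ha | ha <;>
        rcases Int.emod_two_eq_zero_or_one b.j with hb | hb <;>
        rcases Int.emod_two_eq_zero_or_one a.k with ha' | ha' <;>
        rcases Int.emod_two_eq_zero_or_one b.k with hb' | hb' <;>
        rcases Int.emod_two_eq_zero_or_one c.j with hc | hc <;>
        simp [ha, hb, ha', hb', hc] <;> ring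
      · simp only [mul_def, zsgn, emod_two_add]
        rcases Int.emod_two_eq_zero_or_one a.k with ha' | ha' <;>
        rcases Int.emod_two_eq_zero_or_one b.k with hb' | hb' <;>
        simp [ha', hb'] <;> ring
      · simp only [mul_def]; ring)
    (by
      intro a
      ext <;> simp [mul_def, one_def, zsgn])
    (by
      intro a
      ext
      · simp only [mul_def, one_def, inv_def, zsgn]
        rcases Int.emod_two_eq_zero_or_one a.j with ha | ha <;>
        rcases Int.emod_two_eq_zero_or_one a.k with ha' | ha' <;>
        simp [ha, ha', emod_two_add]
      · simp only [mul_def, one_def, inv_def, zsgn, emod_two_neg]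
        ring
      · simp [mul_def, one_def, inv_def])

@[simp] theorem mul_j (g h : B4Model) : (g * h).j = g.j + zsgn g.k * h.j := rfl

@[simp] theorem mul_k (g h : B4Model) : (g * h).k = g.k + h.k := rfl

@[simp] theorem inv_k (g : B4Model) : (g⁻¹).k = -g.k := rfl

@[simp] theorem one_i : (1 : B4Model).i = 0 := rfl

@[simp] theorem one_j : (1 : B4Model).j = 0 := rfl

@[simp] theorem one_k : (1 : B4Model).k = 0 := rfl

@[simp] theorem zsgn_zero : zsgn 0 = 1 := rfl

@[simp] theorem zpow_k (g : B4Model) (n : ℤ) : (g ^ n).k = n * g.k := by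
  induction n with
  | zero => simp
  | succ n ih => rw [zpow_add_one, mul_k, ih]; ring
  | pred n ih => rw [zpow_sub_one, mul_k, ih, inv_k]; ring

theorem zpow_j {g : B4Model} (hk : g.k = 0) (n : ℤ) : (g ^ n).j = n * g.j := by
  induction n with
  | zero => simp
  | succ n ih => rw [zpow_add_one, mul_j, ih, zpow_k, hk]; simp; ring
  | pred n ih => rw [zpow_sub_one, mul_j, ih, zpow_k, hk, inv_def, hk]; simp; ring

@[simp] theorem zpow_x (a n : ℤ) : (⟨a, 0, 0⟩ : B4Model) ^ n = ⟨n * a, 0, 0⟩ := by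
  induction n with
  | zero => ext <;> simp
  | succ n ih => rw [zpow_add_one, ih]; ext <;> simp [mul_def, zsgn]; ring
  | pred n ih => rw [zpow_sub_one, ih]; ext <;> simp [mul_def, inv_def, zsgn]; ring

/-! ### Echelon bases of subgroups of finite index. -/

/-- `⟨a, 0, 0⟩, ⟨s, b, 0⟩, ⟨t, u, c⟩` is an echelon basis of the subgroup `D`. -/
structure HasBasis (D : Subgroup B4Model) (a b c : ℕ) (s t u : ℤ) : Prop where
  a_pos : 0 < a
  b_pos : 0 < b
  c_pos : 0 < c
  mem_x : ⟨a, 0, 0⟩ ∈ D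
  mem_y : ⟨s, b, 0⟩ ∈ D
  mem_z : ⟨t, u, c⟩ ∈ D
  dvd_k : ∀ g ∈ D, (c : ℤ) ∣ g.k
  dvd_j : ∀ g ∈ D, g.k = 0 → (b : ℤ) ∣ g.j
  dvd_i : ∀ g ∈ D, g.k = 0 → g.j = 0 → (a : ℤ) ∣ g.i

namespace HasBasis

variable {D : Subgroup B4Model} {a b c : ℕ} {s t u : ℤ}

/-- Elimination from the last coordinate: right multiplication by powers of the third, then the
second basis element leaves a multiple of the first. -/
theorem eq_closure (h : HasBasis D a b c s t u) :
    D = Subgroup.closure {⟨a, 0, 0⟩, ⟨s, b, 0⟩, ⟨t, u, c⟩} := by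
  apply le_antisymm
  · intro g hg
    obtain ⟨m, hm⟩ := h.dvd_k g hg
    have hg1 := D.mul_mem hg (D.zpow_mem h.mem_z (-m))
    have hk1 : (g * (⟨t, u, c⟩ : B4Model) ^ (-m)).k = 0 := by simp [hm]; ring
    obtain ⟨l, hl⟩ := h.dvd_j _ hg1 hk1
    generalize hg1' : g * (⟨t, u, c⟩ : B4Model) ^ (-m) = g1 at *
    have hg2 := D.mul_mem hg1 (D.zpow_mem h.mem_y (-l))
    have hk2 : (g1 * (⟨s, b, 0⟩ : B4Model) ^ (-l)).k = 0 := by simp [hk1]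
    have hj2 : (g1 * (⟨s, b, 0⟩ : B4Model) ^ (-l)).j = 0 := by
      rw [mul_j, zpow_j rfl, hk1, hl]; simp; ring
    obtain ⟨r, hr⟩ := h.dvd_i _ hg2 hk2 hj2
    generalize hg2' : g1 * (⟨s, b, 0⟩ : B4Model) ^ (-l) = g2 at *
    have : g2 = (⟨a, 0, 0⟩ : B4Model) ^ r := by
      ext <;> simp [hk2, hj2, hr]; ring
    have hgg : g = (⟨a, 0, 0⟩ : B4Model) ^ r * ⟨s, b, 0⟩ ^ l * ⟨t, u, c⟩ ^ m := by
      rw [← this, ← hg2', ← hg1']; group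
    rw [hgg]
    refine mul_mem (mul_mem ?_ ?_) ?_ <;>
        exact zpow_mem (Subgroup.subset_closure (by simp)) _
  · rw [Subgroup.closure_le]
    rintro _ (rfl | rfl | rfl)
    exacts [h.mem_x, h.mem_y, h.mem_z]

/-- In `g * g'⁻¹` the common factor y ^ j * z ^ k cancels, so the first coordinates subtract without
any sign. -/
theorem dvd_sub_i (h : HasBasis D a b c s t u) {g g' : B4Model} (hg : g ∈ D) (hg' : g' ∈ D)
    (hj : g.j = g'.j) (hk : g.k = g'.k) : (a : ℤ) ∣ g.i - g'.i := by
  have hi := h.dvd_i _ (D.mul_mem hg (D.inv_mem hg')) (by simp [hk])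
    (by
      rcases Int.emod_two_eq_zero_or_one g'.k with hr | hr <;> simp [inv_def, hj, hk, zsgn, hr])
  have e : (g * g'⁻¹).i = g.i - g'.i := by
    rcases Int.emod_two_eq_zero_or_one g'.k with hr | hr <;>
    rcases Int.emod_two_eq_zero_or_one g'.j with hq | hq <;>
      simp [mul_def, inv_def, zsgn, hj, hk, hr, hq, emod_two_add] <;> ring
  exact e ▸ hi

/-- The leading entries generate subgroups of ℤ attached to `D`. The residue of `t` is comparable
only for equal `u`, since moving `u` by `b` also moves `t`. -/
theorem unique (h : HasBasis D a b c s t u) {a' b' c' : ℕ} {s' t' u' : ℤ}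
    (h' : HasBasis D a' b' c' s' t' u') : a = a' ∧ b = b' ∧ c = c' ∧ (a : ℤ) ∣ s - s' ∧
      (b : ℤ) ∣ u - u' ∧ (u = u' → (a : ℤ) ∣ t - t') := by
  have ha : a = a' := Nat.dvd_antisymm
    (Int.natCast_dvd_natCast.1 (h.dvd_i _ h'.mem_x rfl rfl))
    (Int.natCast_dvd_natCast.1 (h'.dvd_i _ h.mem_x rfl rfl))
  have hb : b = b' := Nat.dvd_antisymm
    (Int.natCast_dvd_natCast.1 (h.dvd_j _ h'.mem_y rfl))
    (Int.natCast_dvd_natCast.1 (h'.dvd_j _ h.mem_y rfl))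
  have hc : c = c' := Nat.dvd_antisymm
    (Int.natCast_dvd_natCast.1 (h.dvd_k _ h'.mem_z))
    (Int.natCast_dvd_natCast.1 (h'.dvd_k _ h.mem_z))
  subst ha hb hc
  refine ⟨rfl, rfl, rfl, h.dvd_sub_i h.mem_y h'.mem_y rfl rfl, ?_,
    fun hu => h.dvd_sub_i h.mem_z h'.mem_z hu rfl⟩
  have hj := h.dvd_j _ (D.mul_mem h.mem_z (D.inv_mem h'.mem_z)) (by simp)
  convert hj using 1
  rcases Int.emod_two_eq_zero_or_one (c : ℤ) with hr | hr <;>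
    simp [inv_def, zsgn, hr] <;> ring

/-- The basis element `⟨s, b, 0⟩` can be moved by multiples of `a`. -/
theorem change_s (h : HasBasis D a b c s t u) {s' : ℤ} (hs : (a : ℤ) ∣ s' - s) :
    HasBasis D a b c s' t u := by
  obtain ⟨m, hm⟩ := hs
  refine { h with mem_y := ?_ }
  convert D.mul_mem (D.zpow_mem h.mem_x m) h.mem_y using 1
  rw [zpow_x]
  ext <;> simp [mul_def]
  linarith

theorem change_t (h : HasBasis D a b c s t u) {t' : ℤ} (ht : (a : ℤ) ∣ t' - t) :
    HasBasis D a b c s t' u := by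
  obtain ⟨m, hm⟩ := ht
  refine { h with mem_z := ?_ }
  convert D.mul_mem (D.zpow_mem h.mem_x m) h.mem_z using 1
  rw [zpow_x]
  ext <;> simp [mul_def]
  linarith

/-- Multiplying the third basis element by a power of the second also changes its first coordinate,
hence the existential `t'`. -/
theorem change_u (h : HasBasis D a b c s t u) {u' : ℤ} (hu : (b : ℤ) ∣ u' - u) :
    ∃ t', HasBasis D a b c s t' u' := by
  obtain ⟨m, hm⟩ := hu
  have hz := D.mul_mem (D.zpow_mem h.mem_y m) h.mem_z
  refine ⟨((⟨s, b, 0⟩ : B4Model) ^ m * ⟨t, u, c⟩).i, { h with mem_z := ?_ }⟩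
  convert hz using 1
  ext <;> simp [zpow_j]
  linarith

/-- Together with `eq_of_coset` this makes the box [0, a) × [0, b) × [0, c) a transversal of the
left cosets: the coordinates are reduced from last to first. -/
theorem mem_of_mem_coset {p q r : ℤ} (h : HasBasis D a b c s t u)  :
    ∃ i j k : ℕ, i < a ∧ j < b ∧ k < c ∧ (⟨i, j, k⟩ : B4Model)⁻¹ * ⟨p, q, r⟩ ∈ D := by
  have ha := h.a_pos
  have hb := h.b_pos
  have hc := h.c_pos
  have split : ∀ (n : ℤ) (d : ℕ), 0 < d → ∃ (l : ℤ) (e : ℕ), e < d ∧ (e : ℤ) + l * d = n := by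
    intro n d hd
    refine ⟨n / d, (n % d).toNat, ?_, ?_⟩
    · have := Int.emod_lt_of_pos n (show (0 : ℤ) < d by exact_mod_cast hd)
      have := Int.emod_nonneg n (show (d : ℤ) ≠ 0 by exact_mod_cast hd.ne')
      omega
    · rw [Int.toNat_of_nonneg (Int.emod_nonneg n (by exact_mod_cast hd.ne')), mul_comm]
      exact Int.emod_add_mul_ediv n d
  obtain ⟨l, k, hk, hkl⟩ := split r c hc
  generalize hg1 : (⟨p, q, r⟩ : B4Model) * ⟨t, u, c⟩ ^ (-l) = g1
  have hk1 : g1.k = k := by rw [← hg1]; simp; linarith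
  obtain ⟨m, j, hj, hjm⟩ := split g1.j b hb
  -- Right multiplication acts on the second coordinate with sign `zsgn k`; the same sign in the
  -- exponent makes the change exactly -m * b.
  generalize hg2 : g1 * (⟨s, b, 0⟩ : B4Model) ^ (-(zsgn k * m)) = g2
  have hk2 : g2.k = k := by rw [← hg2]; simp [hk1]
  have hj2 : g2.j = j := by
    rw [← hg2, mul_j, zpow_j rfl, hk1, ← hjm]
    rcases Int.emod_two_eq_zero_or_one (k : ℤ) with hr | hr <;> simp [zsgn, hr]
  obtain ⟨n, i, hi, hin⟩ := split g2.i a ha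
  generalize hg3 : g2 * (⟨a, 0, 0⟩ : B4Model) ^ (-(zsgn (g2.j + g2.k) * n)) = g3
  have hk3 : g3 = ⟨i, j, k⟩ := by
    rw [← hg3, zpow_x]
    ext
    · rw [mul_def, ← hin]
      rcases Int.emod_two_eq_zero_or_one (g2.j + g2.k) with hr | hr <;> simp [zsgn, hr]
    · simp [hj2]
    · simp [hk2]
  refine ⟨i, j, k, hi, hj, hk, ?_⟩
  have : (⟨i, j, k⟩ : B4Model)⁻¹ * ⟨p, q, r⟩ =
      (⟨a, 0, 0⟩ : B4Model) ^ (zsgn (g2.j + g2.k) * n) * ⟨s, b, 0⟩ ^ (zsgn k * m) *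
        ⟨t, u, c⟩ ^ l := by
    rw [← hk3, ← hg3, ← hg2, ← hg1]; group
  rw [this]
  exact mul_mem (mul_mem (zpow_mem h.mem_x _) (zpow_mem h.mem_y _)) (zpow_mem h.mem_z _)

theorem eq_of_coset {i j k i' j' k' : ℕ} (h : HasBasis D a b c s t u) (hi : i < a) (hj : j < b)
    (hk : k < c) (hi' : i' < a) (hj' : j' < b) (hk' : k' < c)
    (hm : (⟨i, j, k⟩ : B4Model)⁻¹ * ⟨i', j', k'⟩ ∈ D) : i = i' ∧ j = j' ∧ k = k' := by
  have small : ∀ {d e e' : ℕ}, e < d → e' < d → (d : ℤ) ∣ e' - e → e = e' := by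
    intro d e e' he he' hd
    have := Int.eq_zero_of_abs_lt_dvd hd (by rw [abs_lt]; constructor <;> omega)
    omega
  have h1 := h.dvd_k _ hm
  obtain rfl : k = k' := small hk hk' (by simpa [neg_add_eq_sub] using h1)
  have h2 := h.dvd_j _ hm (by simp)
  obtain rfl : j = j' := by
    apply small hj hj'
    rcases Int.emod_two_eq_zero_or_one (k : ℤ) with hr | hr <;>
      simp [inv_def, zsgn, hr] at h2
    · simpa [neg_add_eq_sub] using h2
    · rw [dvd_sub_comm]; simpa [sub_eq_add_neg] using h2
  have h3 := h.dvd_i _ hm (by simp) (by simp [inv_def, zsgn]; ring)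
  refine ⟨small hi hi' ?_, rfl, rfl⟩
  rcases Int.emod_two_eq_zero_or_one (k : ℤ) with hr | hr <;>
    rcases Int.emod_two_eq_zero_or_one (j : ℤ) with hr' | hr' <;>
    simp [mul_def, inv_def, zsgn, hr, hr', emod_two_add] at h3
  · rwa [neg_add_eq_sub] at h3
  · rw [dvd_sub_comm]; rwa [sub_eq_add_neg]
  · rw [dvd_sub_comm]; rwa [sub_eq_add_neg]
  · convert h3 using 1; ring

theorem index_eq (h : HasBasis D a b c s t u) : D.index = a * b * c := by
  let f : Fin a × Fin b × Fin c → B4Model ⧸ D :=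
    fun v => QuotientGroup.mk (⟨v.1, v.2.1, v.2.2⟩ : B4Model)
  have hf : Function.Bijective f := by
    constructor
    · rintro ⟨i, j, k⟩ ⟨i', j', k'⟩ he
      obtain ⟨h1, h2, h3⟩ := h.eq_of_coset i.2 j.2 k.2 i'.2 j'.2 k'.2 (QuotientGroup.eq.1 he)
      ext <;> assumption
    · intro q
      induction q using QuotientGroup.induction_on with
      | H g =>
        obtain ⟨i, j, k, hi, hj, hk, hm⟩ := h.mem_of_mem_coset (p := g.i) (q := g.j) (r := g.k)
        exact ⟨(⟨i, hi⟩, ⟨j, hj⟩, ⟨k, hk⟩), QuotientGroup.eq.2 hm⟩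
  rw [Subgroup.index, ← Nat.card_congr (Equiv.ofBijective f hf)]
  simp [mul_assoc]

end HasBasis

theorem _root_.AddSubgroup.exists_pos_generator (Q : AddSubgroup ℤ) {m : ℤ} (hm : m ∈ Q)
    (h0 : m ≠ 0) : ∃ a : ℕ, 0 < a ∧ (a : ℤ) ∈ Q ∧ ∀ n ∈ Q, (a : ℤ) ∣ n := by
  obtain ⟨d, rfl⟩ := Int.subgroup_cyclic Q
  have hd : d ∈ AddSubgroup.closure {d} := AddSubgroup.subset_closure rfl
  have hdvd : ∀ n ∈ AddSubgroup.closure {d}, d ∣ n := by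
    intro n hn
    obtain ⟨l, rfl⟩ := AddSubgroup.mem_closure_singleton.1 hn
    simp
  refine ⟨d.natAbs, ?_, ?_, fun n hn => Int.natAbs_dvd.2 (hdvd n hn)⟩
  · rw [Int.natAbs_pos]
    rintro rfl
    exact h0 (zero_dvd_iff.1 (hdvd m hm))
  · rcases Int.natAbs_eq d with h | h
    · rwa [← h]
    · rw [← neg_mem_iff, ← h]; exact hd

/-- The leading coordinates of D ∩ ⟨x⟩, of D ∩ {k = 0} and of D form three subgroups of ℤ. Finite
index puts nonzero powers of x, y, z in D, so these are nonzero; their positive generators are a, b,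
c. -/
theorem exists_hasBasis (D : Subgroup B4Model) (hD : D.index ≠ 0) :
    ∃ (a b c : ℕ) (s t u : ℤ), HasBasis D a b c s t u := by
  have hpow : ∀ g : B4Model, ∃ n : ℤ, n ≠ 0 ∧ g ^ n ∈ D := by
    intro g
    obtain ⟨n, h1, -, h3⟩ := Subgroup.exists_pow_mem_of_index_ne_zero hD g
    exact ⟨n, by omega, by simpa using h3⟩
  let Qx : AddSubgroup ℤ :=
    { carrier := {i | (⟨i, 0, 0⟩ : B4Model) ∈ D}
      zero_mem' := D.one_mem
      add_mem' := by
        intro p q hp hq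
        have := D.mul_mem hp hq
        simpa [mul_def] using this
      neg_mem' := by
        intro p hp
        have := D.inv_mem hp
        simpa [inv_def] using this }
  let Qy : AddSubgroup ℤ :=
    { carrier := {j | ∃ g ∈ D, g.k = 0 ∧ g.j = j}
      zero_mem' := ⟨1, D.one_mem, rfl, rfl⟩
      add_mem' := by
        rintro _ _ ⟨g, hg, hk, rfl⟩ ⟨g', hg', hk', rfl⟩
        exact ⟨g * g', D.mul_mem hg hg', by simp [hk, hk'], by simp [hk]⟩
      neg_mem' := by
        rintro _ ⟨g, hg, hk, rfl⟩
        exact ⟨g⁻¹, D.inv_mem hg, by simp [hk], by simp [inv_def, hk]⟩ }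
  let Qz : AddSubgroup ℤ :=
    { carrier := {k | ∃ g ∈ D, g.k = k}
      zero_mem' := ⟨1, D.one_mem, rfl⟩
      add_mem' := by
        rintro _ _ ⟨g, hg, rfl⟩ ⟨g', hg', rfl⟩
        exact ⟨g * g', D.mul_mem hg hg', by simp⟩
      neg_mem' := by
        rintro _ ⟨g, hg, rfl⟩
        exact ⟨g⁻¹, D.inv_mem hg, by simp⟩ }
  obtain ⟨n, hn, hx⟩ := hpow ⟨1, 0, 0⟩
  obtain ⟨m, hm, hy⟩ := hpow ⟨0, 1, 0⟩
  obtain ⟨l, hl, hz⟩ := hpow ⟨0, 0, 1⟩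
  obtain ⟨a, ha, ha1, ha2⟩ := Qx.exists_pos_generator (m := n)
    (by rw [zpow_x, mul_one] at hx; exact hx) hn
  obtain ⟨b, hb, ⟨gb, hb1, hb2, hb3⟩, hb4⟩ := Qy.exists_pos_generator (m := m)
    ⟨_, hy, by simp, by simp [zpow_j]⟩ hm
  obtain ⟨c, hc, ⟨gc, hc1, hc2⟩, hc3⟩ := Qz.exists_pos_generator (m := l)
    ⟨_, hz, by simp⟩ hl
  refine ⟨a, b, c, gb.i, gc.i, gc.j, ha, hb, hc, ha1, ?_, ?_, fun g hg => hc3 _ ⟨g, hg, rfl⟩,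
    fun g hg hk => hb4 _ ⟨g, hg, hk, rfl⟩, ?_⟩
  · rw [← hb2, ← hb3]; exact hb1
  · rw [← hc2]; exact hc1
  · rintro ⟨i, j, k⟩ hg rfl rfl
    exact ha2 _ hg

/-- The closure of elements in echelon form has these as a basis as soon as the conjugate of the
second by the third has the right shape. -/
theorem hasBasis_closure {a b c : ℕ} {s t u : ℤ} (ha : 0 < a) (hb : 0 < b) (hc : 0 < c)
    (m : ℤ) (h : (⟨t, u, c⟩ : B4Model) * ⟨s, b, 0⟩ = ⟨m * a, 0, 0⟩ * ⟨s, b, 0⟩ * ⟨t, u, c⟩ ∨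
      (⟨t, u, c⟩ : B4Model) * ⟨s, b, 0⟩ = ⟨m * a, 0, 0⟩ * ⟨s, b, 0⟩⁻¹ * ⟨t, u, c⟩) :
    HasBasis (Subgroup.closure {⟨a, 0, 0⟩, ⟨s, b, 0⟩, ⟨t, u, c⟩}) a b c s t u := by
  have hinv : ∀ p : ℤ, (⟨p, 0, 0⟩ : B4Model)⁻¹ = ⟨-p, 0, 0⟩ := by
    intro p; ext <;> simp [inv_def]
  -- Every element acts on ⟨x⟩ by a sign, so X generates a normal subgroup of the whole group.
  have conj : ∀ g : B4Model, g * ⟨a, 0, 0⟩ * g⁻¹ ∈ Subgroup.zpowers (⟨a, 0, 0⟩ : B4Model) := by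
    intro g
    rcases Int.emod_two_eq_zero_or_one (g.j + g.k) with hr | hr
    · apply mem_zpowers_of_eq
      rw [mul_inv_eq_iff_eq_mul]
      ext <;> simp [mul_def, zsgn, hr]
      ring
    · apply mem_zpowers_of_eq_inv
      rw [mul_inv_eq_iff_eq_mul, hinv]
      ext <;> simp [mul_def, zsgn, hr]
      ring
  have conj' : ∀ g : B4Model, g⁻¹ * ⟨a, 0, 0⟩ * g ∈ Subgroup.zpowers (⟨a, 0, 0⟩ : B4Model) := by
    intro g
    simpa using conj g⁻¹
  rw [← zpow_x] at h
  generalize hX : (⟨a, 0, 0⟩ : B4Model) = X at *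
  generalize hY : (⟨s, b, 0⟩ : B4Model) = Y at *
  generalize hZ : (⟨t, u, c⟩ : B4Model) = Z at *
  have hxK : Subgroup.zpowers X ≤ Subgroup.closure {X, Y} := by
    rw [Subgroup.zpowers_le]; exact Subgroup.subset_closure (by simp)
  have hyK : Y ∈ Subgroup.closure {X, Y} := Subgroup.subset_closure (by simp)
  have hpK : X ^ m ∈ Subgroup.closure {X, Y} := hxK ⟨m, rfl⟩
  have hqK : Z⁻¹ * X ^ m * Z ∈ Subgroup.closure {X, Y} := by
    have := hxK (conj_zpow_mem (g := Z⁻¹) (by simpa using conj' Z) m)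
    simpa using this
  -- The divisibilities are read off from this normal form; the hypothesis on Z Y Z⁻¹ is what makes
  -- Z normalize ⟨X, Y⟩.
  have nf : ∀ g ∈ Subgroup.closure {X, Y, Z}, ∃ i j k : ℤ, g = X ^ i * Y ^ j * Z ^ k := by
    intro g hg
    refine exists_zpow_mul_zpow_mul_zpow_of_mem_closure (conj _) (conj' _) (conj _) (conj' _)
      ?_ ?_ hg
    · rcases h with h | h
      · rw [h, mul_inv_cancel_right]; exact mul_mem hpK hyK
      · rw [h, mul_inv_cancel_right]; exact mul_mem hpK (inv_mem hyK)
    · rcases h with h | h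
      · have : Z⁻¹ * Y * Z = (Z⁻¹ * X ^ m * Z)⁻¹ * Y := by
          calc Z⁻¹ * Y * Z = (Z⁻¹ * X ^ m * Z)⁻¹ * (Z⁻¹ * (X ^ m * Y * Z)) := by group
            _ = _ := by rw [← h]; group
        rw [this]; exact mul_mem (inv_mem hqK) hyK
      · have : Z⁻¹ * Y * Z = ((Z⁻¹ * X ^ m * Z)⁻¹ * Y)⁻¹ := by
          calc Z⁻¹ * Y * Z = ((Z⁻¹ * X ^ m * Z)⁻¹ * (Z⁻¹ * (X ^ m * Y⁻¹ * Z)))⁻¹ := by group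
            _ = _ := by rw [← h]; group
        rw [this]; exact inv_mem (mul_mem (inv_mem hqK) hyK)
  have kk : ∀ i j k : ℤ, (X ^ i * Y ^ j * Z ^ k).k = k * c := by
    intro i j k; simp [← hX, ← hY, ← hZ]
  have jj : ∀ i j : ℤ, (X ^ i * Y ^ j).j = j * b := by
    intro i j; simp [← hX, ← hY, zpow_j]
  refine ⟨ha, hb, hc, ?_, ?_, ?_, ?_, ?_, ?_⟩
  · rw [hX]; exact Subgroup.subset_closure (by simp)
  · rw [hY]; exact Subgroup.subset_closure (by simp)
  · rw [hZ]; exact Subgroup.subset_closure (by simp)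
  · intro g hg
    obtain ⟨i, j, k, rfl⟩ := nf g hg
    rw [kk]; exact dvd_mul_left _ _
  · intro g hg hk
    obtain ⟨i, j, k, rfl⟩ := nf g hg
    rw [kk] at hk
    obtain rfl : k = 0 := by simpa [hc.ne'] using hk
    rw [zpow_zero, mul_one, jj]; exact dvd_mul_left _ _
  · intro g hg hk hj
    obtain ⟨i, j, k, rfl⟩ := nf g hg
    rw [kk] at hk
    obtain rfl : k = 0 := by simpa [hc.ne'] using hk
    rw [zpow_zero, mul_one, jj] at hj
    obtain rfl : j = 0 := by simpa [hb.ne'] using hj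
    simp [← hX]

end B4Model

/-! ### Isomorphism types of subgroups with an echelon basis. -/

namespace B4Model

theorem inv_x (a : ℤ) : (⟨a, 0, 0⟩ : B4Model)⁻¹ = ⟨-a, 0, 0⟩ := by
  ext <;> simp [inv_def]

theorem zpow_of_even {s b : ℤ} (hb : b % 2 = 0) (n : ℤ) :
    (⟨s, b, 0⟩ : B4Model) ^ n = ⟨n * s, n * b, 0⟩ := by
  induction n with
  | zero => ext <;> simp
  | succ n ih =>
    rw [zpow_add_one, ih]; ext <;> simp [mul_def, zsgn, Int.mul_emod, hb] <;> ring
  | pred n ih =>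
    rw [zpow_sub_one, ih]; ext <;> simp [mul_def, inv_def, zsgn, Int.mul_emod, hb] <;> ring

/-- Exponents vanish one after another by triangularity. Several orders of the basis occur because
its elements take different roles in the presentations. -/
theorem zPowIndependent_xyz {a s b t u c : ℤ} (ha : a ≠ 0) (hb : b ≠ 0) (hc : c ≠ 0) :
    ZPowIndependent (⟨a, 0, 0⟩ : B4Model) ⟨s, b, 0⟩ ⟨t, u, c⟩ := by
  intro i j k h
  have hk := congrArg B4Model.k h
  simp [hc] at hk
  subst hk
  have hj := congrArg B4Model.j h
  simp [zpow_j, hb] at hj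
  subst hj
  have hi := congrArg B4Model.i h
  simp [ha] at hi
  exact ⟨hi, rfl, rfl⟩

theorem zPowIndependent_xzy {a s b t u c : ℤ} (ha : a ≠ 0) (hb : b ≠ 0) (hc : c ≠ 0) :
    ZPowIndependent (⟨a, 0, 0⟩ : B4Model) ⟨t, u, c⟩ ⟨s, b, 0⟩ := by
  intro i j k h
  have hk := congrArg B4Model.k h
  simp [hc] at hk
  subst hk
  have hj := congrArg B4Model.j h
  simp [zpow_j, hb] at hj
  subst hj
  have hi := congrArg B4Model.i h
  simp [ha] at hi
  exact ⟨hi, rfl, rfl⟩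

theorem zPowIndependent_yxz {a s b t u c : ℤ} (ha : a ≠ 0) (hb : b ≠ 0) (hc : c ≠ 0) :
    ZPowIndependent (⟨s, b, 0⟩ : B4Model) ⟨a, 0, 0⟩ ⟨t, u, c⟩ := by
  intro i j k h
  have hk := congrArg B4Model.k h
  simp [hc] at hk
  subst hk
  have hj := congrArg B4Model.j h
  simp [zpow_j, hb] at hj
  subst hj
  have hi := congrArg B4Model.i h
  simp [ha] at hi
  exact ⟨rfl, hi, rfl⟩

/-- The first two elements are not in echelon order, but even second coordinates make their powers
and products coordinatewise. -/
theorem zPowIndependent_of_even {d s b t u c : ℤ} (hd : d ≠ 0) (hs : s ≠ 0)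
    (hd2 : d % 2 = 0) (hb2 : b % 2 = 0) (hc : c ≠ 0) :
    ZPowIndependent (⟨0, d, 0⟩ : B4Model) ⟨s, b, 0⟩ ⟨t, u, c⟩ := by
  intro i j k h
  have hk := congrArg B4Model.k h
  simp [hc] at hk
  subst hk
  rw [zpow_of_even hd2, zpow_of_even hb2] at h
  have hi := congrArg B4Model.i h
  simp [mul_def, zsgn, Int.mul_emod, hd2, hs] at hi
  subst hi
  have hj := congrArg B4Model.j h
  simp [hd] at hj
  exact ⟨hj, rfl, rfl⟩

/-- Used to match the sign of x in the relation z y z⁻¹ = x y of ℬ₂. -/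
theorem closure_insert_inv_x (a : ℤ) (S : Set B4Model) :
    Subgroup.closure (insert ⟨-a, 0, 0⟩ S) = Subgroup.closure (insert ⟨a, 0, 0⟩ S) := by
  rw [← inv_x, ← Set.singleton_union, ← Set.singleton_union, Subgroup.closure_union,
    Subgroup.closure_union, Subgroup.closure_singleton_inv]

namespace HasBasis

variable {D : Subgroup B4Model} {a b c : ℕ} {s t u : ℤ}

theorem mulEquiv_piG1 (h : HasBasis D a b c s t u) (hb : (b : ℤ) % 2 = 0)
    (hc : (c : ℤ) % 2 = 0) (hu : u % 2 = 0) : Nonempty (D ≃* PiG1) := by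
  obtain ⟨ha0, hb0, hc0⟩ := And.intro h.a_pos (And.intro h.b_pos h.c_pos)
  rw [h.eq_closure]
  refine nonempty_closure_mulEquiv_piG1 ?_ ?_ ?_
    (zPowIndependent_xyz (by omega) (by omega) (by omega)) <;> ext <;>
    simp [mul_def, zsgn, hb, hc, hu, emod_two_add] <;> ring

theorem mulEquiv_piG2 (h : HasBasis D a b c s t u) (hb : (b : ℤ) % 2 = 0)
    (hc : (c : ℤ) % 2 = 1) (hu : u % 2 = 0) : Nonempty (D ≃* PiG2) := by
  obtain ⟨ha0, hb0, hc0⟩ := And.intro h.a_pos (And.intro h.b_pos h.c_pos)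
  rw [h.eq_closure]
  refine nonempty_closure_mulEquiv_piG2 ?_ ?_ ?_
    (zPowIndependent_xyz (by omega) (by omega) (by omega)) <;>
    try rw [mul_inv_eq_iff_eq_mul]
  all_goals ext <;> simp [mul_def, inv_def, zsgn, hb, hc, hu, emod_two_add] <;> ring

theorem mulEquiv_piB1_of_even (h : HasBasis D a b c s t u) (hb : (b : ℤ) % 2 = 0)
    (hu : u % 2 = 1) (hs : s = 0) : Nonempty (D ≃* PiB1) := by
  obtain ⟨ha0, hb0, hc0⟩ := And.intro h.a_pos (And.intro h.b_pos h.c_pos)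
  subst hs
  rw [h.eq_closure]
  rcases Int.emod_two_eq_zero_or_one (c : ℤ) with hc | hc
  · refine nonempty_closure_mulEquiv_piB1 ?_ ?_ ?_
      (zPowIndependent_xyz (by omega) (by omega) (by omega)) <;>
      try rw [mul_inv_eq_iff_eq_mul]
    all_goals ext <;> simp [mul_def, inv_def, zsgn, hb, hc, hu, emod_two_add] <;> ring
  -- For c odd, Z centralizes X and inverts Y, so X and Y exchange roles.
  · rw [Set.insert_comm]
    refine nonempty_closure_mulEquiv_piB1 ?_ ?_ ?_
      (zPowIndependent_yxz (by omega) (by omega) (by omega)) <;>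
      try rw [mul_inv_eq_iff_eq_mul]
    all_goals ext <;> simp [mul_def, inv_def, zsgn, hb, hc, hu, emod_two_add] <;> ring

/-- Here Y inverts X and Z is central, so Y plays the generator z of ℬ₁ and Z plays y. -/
theorem mulEquiv_piB1_of_odd (h : HasBasis D a b c s t u) (hb : (b : ℤ) % 2 = 1)
    (hc : (c : ℤ) % 2 = 0) (hu : u % 2 = 0) (ht : t = 0) : Nonempty (D ≃* PiB1) := by
  obtain ⟨ha0, hb0, hc0⟩ := And.intro h.a_pos (And.intro h.b_pos h.c_pos)
  subst ht
  rw [h.eq_closure, Set.pair_comm]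
  refine nonempty_closure_mulEquiv_piB1 ?_ ?_ ?_
    (zPowIndependent_xzy (by omega) (by omega) (by omega)) <;>
    try rw [mul_inv_eq_iff_eq_mul]
  all_goals ext <;> simp [mul_def, inv_def, zsgn, hb, hc, hu, emod_two_add] <;> ring

theorem mulEquiv_piB2_of_even (h : HasBasis D a b c s t u) (hb : (b : ℤ) % 2 = 0)
    (hu : u % 2 = 1) (hs : 2 * s = a) : Nonempty (D ≃* PiB2) := by
  obtain ⟨ha0, hb0, hc0⟩ := And.intro h.a_pos (And.intro h.b_pos h.c_pos)
  rw [h.eq_closure, ← hs]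
  rcases Int.emod_two_eq_zero_or_one (c : ℤ) with hc | hc
  · rw [← closure_insert_inv_x]
    refine nonempty_closure_mulEquiv_piB2 ?_ ?_ ?_
      (zPowIndependent_xyz (by omega) (by omega) (by omega)) <;>
      try rw [mul_inv_eq_iff_eq_mul]
    all_goals ext <;> simp [mul_def, inv_def, zsgn, hb, hc, hu, emod_two_add] <;> ring
  -- For c odd, Z centralizes X, but Z Y Z⁻¹ = ⟨s, -b, 0⟩ = ⟨0, -2b, 0⟩ * Y and Z inverts ⟨0, -2b,
  -- 0⟩, which therefore serves as x. It may replace X because X = ⟨0, -2b, 0⟩ * Y² when a = 2s.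
  · have hcl : Subgroup.closure ({⟨2 * s, 0, 0⟩, ⟨s, b, 0⟩, ⟨t, u, c⟩} : Set B4Model) =
        Subgroup.closure {⟨0, -2 * b, 0⟩, ⟨s, b, 0⟩, ⟨t, u, c⟩} := by
      have e : (⟨2 * s, 0, 0⟩ : B4Model) = ⟨0, -2 * b, 0⟩ * ⟨s, b, 0⟩ ^ (2 : ℤ) := by
        rw [zpow_of_even hb]
        ext <;> simp [mul_def, zsgn]
      have e' : (⟨0, -2 * b, 0⟩ : B4Model) = ⟨2 * s, 0, 0⟩ * ⟨s, b, 0⟩ ^ (-2 : ℤ) := by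
        rw [zpow_of_even hb]
        ext <;> simp [mul_def, zsgn]
      apply le_antisymm <;> rw [Subgroup.closure_le]
      · rintro g (rfl | rfl | rfl)
        · rw [e]
          exact mul_mem (Subgroup.subset_closure (by simp))
            (zpow_mem (Subgroup.subset_closure (by simp)) _)
        · exact Subgroup.subset_closure (by simp)
        · exact Subgroup.subset_closure (by simp)
      · rintro g (rfl | rfl | rfl)
        · rw [e']
          exact mul_mem (Subgroup.subset_closure (by simp))
            (zpow_mem (Subgroup.subset_closure (by simp)) _)
        · exact Subgroup.subset_closure (by simp)
        · exact Subgroup.subset_closure (by simp)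
    rw [hcl]
    refine nonempty_closure_mulEquiv_piB2 ?_ ?_ ?_
      (zPowIndependent_of_even (by omega) (by omega) (by omega) hb (by omega)) <;>
      try rw [mul_inv_eq_iff_eq_mul]
    all_goals ext <;> simp [mul_def, inv_def, zsgn, hb, hc, hu, emod_two_add] <;> ring

theorem mulEquiv_piB2_of_odd (h : HasBasis D a b c s t u) (hb : (b : ℤ) % 2 = 1)
    (hc : (c : ℤ) % 2 = 0) (hu : u % 2 = 0) (ht : 2 * t = a) : Nonempty (D ≃* PiB2) := by
  obtain ⟨ha0, hb0, hc0⟩ := And.intro h.a_pos (And.intro h.b_pos h.c_pos)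
  rw [h.eq_closure, Set.pair_comm, ← ht, ← closure_insert_inv_x]
  refine nonempty_closure_mulEquiv_piB2 ?_ ?_ ?_
    (zPowIndependent_xzy (by omega) (by omega) (by omega)) <;>
    try rw [mul_inv_eq_iff_eq_mul]
  all_goals ext <;> simp [mul_def, inv_def, zsgn, hb, hc, hu, emod_two_add] <;> ring

theorem mulEquiv_piB4 (h : HasBasis D a b c s t u) (hb : (b : ℤ) % 2 = 1)
    (hc : (c : ℤ) % 2 = 1) (hu : u % 2 = 0) (ht : 2 * t = 2 * s - 1 + a) :
    Nonempty (D ≃* PiB4) := by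
  obtain ⟨ha0, hb0, hc0⟩ := And.intro h.a_pos (And.intro h.b_pos h.c_pos)
  rw [h.eq_closure]
  obtain ha : (a : ℤ) = 2 * t - 2 * s + 1 := by linarith
  rw [ha]
  refine nonempty_closure_mulEquiv_piB4 ?_ ?_ ?_
    (zPowIndependent_xyz (by omega) (by omega) (by omega)) <;>
    try rw [mul_inv_eq_iff_eq_mul]
  all_goals ext <;> simp [mul_def, inv_def, zsgn, hb, hc, hu, emod_two_add] <;> ring

/-- The integrality condition when `c` is even. -/
theorem dvd_of_even (h : HasBasis D a b c s t u) (hc : (c : ℤ) % 2 = 0) :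
    (a : ℤ) ∣ t + zsgn u * s - (s + zsgn b * t) := by
  -- For c even, Z Y and Y Z differ only in the first coordinate.
  have := h.dvd_sub_i (D.mul_mem h.mem_z h.mem_y) (D.mul_mem h.mem_y h.mem_z)
    (by simp [zsgn, hc]; ring) (by simp)
  simpa [mul_def, hc, zsgn, emod_two_add] using this

/-- The integrality condition when `c` is odd. -/
theorem dvd_of_odd (h : HasBasis D a b c s t u) (hc : (c : ℤ) % 2 = 1) :
    (a : ℤ) ∣ t - zsgn u * s + zsgn u * (b % 2) - (-zsgn b * s + zsgn b * t) := by
  -- For c odd, Z reverses y, so Z Y is compared with Y⁻¹ Z.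
  have := h.dvd_sub_i (D.mul_mem h.mem_z h.mem_y) (D.mul_mem (D.inv_mem h.mem_y) h.mem_z)
    (by simp [inv_def, zsgn, hc]; ring) (by simp)
  convert this using 1
  simp [mul_def, inv_def, hc, zsgn, emod_two_add]
  ring

end HasBasis

end B4Model

/-! ### Divisor sums as Dirichlet convolutions. -/

/-- The indicator of `2`: convolution with it substitutes `n / 2`. -/
def indicatorTwo : ArithmeticFunction ℤ := ⟨fun n => if n = 2 then 1 else 0, by simp⟩

/-- The identity as an arithmetic function. -/
def idArith : ArithmeticFunction ℤ := ⟨fun n => n, by simp⟩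

/-- The square as an arithmetic function. -/
def sqArith : ArithmeticFunction ℤ := ⟨fun n => n ^ 2, by simp⟩

/-- The integral zeta function. -/
def oneArith : ArithmeticFunction ℤ :=
  ((ArithmeticFunction.zeta : ArithmeticFunction ℕ) : ArithmeticFunction ℤ)

theorem indicatorTwo_mul_apply (f : ArithmeticFunction ℤ) (n : ℕ) :
    (indicatorTwo * f) n = atQuot f n 2 := by
  rw [ArithmeticFunction.mul_apply, atQuot]
  rcases Nat.eq_zero_or_pos n with rfl | hn
  · simp
  split_ifs with h
  · obtain ⟨m, rfl⟩ := h
    rw [Finset.sum_eq_single (2, m)]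
    · simp [indicatorTwo]
    · rintro ⟨p, q⟩ hpq hne
      rw [Nat.mem_divisorsAntidiagonal] at hpq
      have : p ≠ 2 := by
        rintro rfl
        apply hne
        have : q = m := by simpa using hpq.1
        rw [this]
      simp [indicatorTwo, this]
    · intro hm
      exact absurd (Nat.mem_divisorsAntidiagonal.2 ⟨rfl, hn.ne'⟩) hm
  · apply Finset.sum_eq_zero
    rintro ⟨p, q⟩ hpq
    rw [Nat.mem_divisorsAntidiagonal] at hpq
    have : p ≠ 2 := by
      rintro rfl
      exact h ⟨q, hpq.1.symm⟩
    simp [indicatorTwo, this]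

theorem atQuot_atQuot (f : ℕ → ℤ) (n k l : ℕ) (hl : 0 < l) :
    atQuot (fun m => atQuot f m k) n l = atQuot f n (l * k) := by
  simp only [atQuot]
  by_cases h : l ∣ n
  · obtain ⟨m, rfl⟩ := h
    simp [Nat.mul_dvd_mul_iff_left hl, Nat.mul_div_cancel_left _ hl, Nat.mul_div_mul_left _ _ hl]
  · have : ¬ l * k ∣ n := fun h' => h ((dvd_mul_right _ _).trans h')
    simp [h, this]

/-- `chi` as a convolution. -/
def chiArith : ArithmeticFunction ℤ := idArith * idArith * oneArith

/-- `omega` as a convolution. -/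
def omegaArith : ArithmeticFunction ℤ := sqArith * idArith * oneArith

theorem sigma_one_eq (n : ℕ) : ((σ 1 n : ℕ) : ℤ) = (idArith * oneArith) n := by
  rw [oneArith, ArithmeticFunction.coe_mul_zeta_apply, ArithmeticFunction.sigma_one_apply]
  simp [idArith]

theorem chi_eq : chi = chiArith := by
  funext n
  rw [chiArith, mul_assoc, ArithmeticFunction.mul_apply, chi]
  refine Finset.sum_congr rfl fun p _ => ?_
  rw [Nat.cast_mul, sigma_one_eq]
  simp [idArith]

theorem omega_eq : omega = omegaArith := by
  -- For d = e f, the summand d e of d σ₁(d) is e² f.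
  have key : ∀ d : ℕ, (d : ℤ) * (σ 1 d : ℕ) = (sqArith * idArith) d := by
    intro d
    rw [sigma_one_eq, ArithmeticFunction.mul_apply, ArithmeticFunction.mul_apply, Finset.mul_sum]
    refine Finset.sum_congr rfl fun p hp => ?_
    obtain ⟨rfl, h0⟩ := Nat.mem_divisorsAntidiagonal.1 hp
    have hp2 : p.2 ≠ 0 := right_ne_zero_of_mul h0
    simp [oneArith, idArith, sqArith, hp2]
    ring
  funext n
  rw [omegaArith, ArithmeticFunction.mul_apply, omega]
  refine Finset.sum_congr rfl fun p hp => ?_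
  obtain ⟨rfl, h0⟩ := Nat.mem_divisorsAntidiagonal.1 hp
  have hp2 : p.2 ≠ 0 := right_ne_zero_of_mul h0
  rw [Nat.cast_mul, key]
  simp [oneArith, hp2]

theorem indicatorTwo_sq_mul_apply (f : ArithmeticFunction ℤ) (n : ℕ) :
    (indicatorTwo ^ 2 * f) n = atQuot f n 4 := by
  have h : ⇑(indicatorTwo * f) = fun m => atQuot f m 2 :=
    funext (indicatorTwo_mul_apply f)
  rw [pow_two, mul_assoc, indicatorTwo_mul_apply, h, atQuot_atQuot _ _ _ _ two_pos]
  norm_num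

theorem indicatorTwo_cube_mul_apply (f : ArithmeticFunction ℤ) (n : ℕ) :
    (indicatorTwo ^ 3 * f) n = atQuot f n 8 := by
  have h : ⇑(indicatorTwo ^ 2 * f) = fun m => atQuot f m 4 :=
    funext (indicatorTwo_sq_mul_apply f)
  rw [pow_succ', mul_assoc, indicatorTwo_mul_apply, h, atQuot_atQuot _ _ _ _ two_pos]
  norm_num

/-! ### Parameter sets and their cardinalities. -/

section ParameterSets

/-- Even residues modulo an even number. -/
noncomputable def evenRes (b : ℕ) : Finset ℤ :=
  if 2 ∣ b then (Finset.Ico (0 : ℤ) (b / 2 : ℕ)).image (fun v => 2 * v) else ∅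

/-- Odd residues modulo an even number. -/
noncomputable def oddRes (b : ℕ) : Finset ℤ :=
  if 2 ∣ b then (Finset.Ico (0 : ℤ) (b / 2 : ℕ)).image (fun v => 2 * v + 1) else ∅

/-- Even representatives of the residues modulo an odd number. -/
noncomputable def evenRep (b : ℕ) : Finset ℤ :=
  if 2 ∣ b then ∅ else (Finset.Ico (0 : ℤ) b).image (fun v => 2 * v)

/-- The solutions of `2 * s = a`. -/
def halfSet (a : ℕ) : Finset ℤ := if 2 ∣ a then {((a / 2 : ℕ) : ℤ)} else ∅

/-- The solutions of `2 * t = 2 * s - 1 + a` with `s` a residue modulo `a`. -/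
noncomputable def shiftPairs (a : ℕ) : Finset (ℤ × ℤ) :=
  if 2 ∣ a then ∅ else (Finset.Ico (0 : ℤ) a).image (fun s => (s, s + ((a / 2 : ℕ) : ℤ)))

/-- A point if `c` is even. -/
def evenInd (c : ℕ) : Finset Unit := if 2 ∣ c then {()} else ∅

/-- A point if `c` is odd. -/
def oddInd (c : ℕ) : Finset Unit := if 2 ∣ c then ∅ else {()}

theorem mem_evenRes {b : ℕ} {u : ℤ} :
    u ∈ evenRes b ↔ (b : ℤ) % 2 = 0 ∧ u % 2 = 0 ∧ 0 ≤ u ∧ u < b := by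
  unfold evenRes
  split_ifs with h
  · simp only [Finset.mem_image, Finset.mem_Ico]
    constructor
    · rintro ⟨v, hv, rfl⟩; omega
    · intro hu; exact ⟨u / 2, by omega, by omega⟩
  · simp; omega

theorem mem_oddRes {b : ℕ} {u : ℤ} :
    u ∈ oddRes b ↔ (b : ℤ) % 2 = 0 ∧ u % 2 = 1 ∧ 0 ≤ u ∧ u < b := by
  unfold oddRes
  split_ifs with h
  · simp only [Finset.mem_image, Finset.mem_Ico]
    constructor
    · rintro ⟨v, hv, rfl⟩; omega
    · intro hu; exact ⟨u / 2, by omega, by omega⟩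
  · simp; omega

theorem mem_evenRep {b : ℕ} {u : ℤ} :
    u ∈ evenRep b ↔ (b : ℤ) % 2 = 1 ∧ u % 2 = 0 ∧ 0 ≤ u ∧ u < 2 * b := by
  unfold evenRep
  split_ifs with h
  · simp; omega
  · simp only [Finset.mem_image, Finset.mem_Ico]
    constructor
    · rintro ⟨v, hv, rfl⟩; omega
    · intro hu; exact ⟨u / 2, by omega, by omega⟩

theorem mem_halfSet {a : ℕ} {s : ℤ} : s ∈ halfSet a ↔ 2 * s = a := by
  unfold halfSet
  split_ifs with h
  · rw [Finset.mem_singleton]; omega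
  · simp; omega

theorem mem_shiftPairs {a : ℕ} {s t : ℤ} :
    (s, t) ∈ shiftPairs a ↔ 0 ≤ s ∧ s < a ∧ 2 * t = 2 * s - 1 + a := by
  unfold shiftPairs
  split_ifs with h
  · simp; omega
  · simp only [Finset.mem_image, Finset.mem_Ico, Prod.mk.injEq]
    constructor
    · rintro ⟨v, hv, rfl, rfl⟩; omega
    · intro hu; exact ⟨s, by omega, rfl, by omega⟩

theorem mem_evenInd {c : ℕ} : () ∈ evenInd c ↔ (c : ℤ) % 2 = 0 := by
  unfold evenInd
  split_ifs with h
  · simp; omega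
  · simp; omega

theorem mem_oddInd {c : ℕ} : () ∈ oddInd c ↔ (c : ℤ) % 2 = 1 := by
  unfold oddInd
  split_ifs with h
  · simp; omega
  · simp; omega

theorem card_evenRes (b : ℕ) : ((evenRes b).card : ℤ) = (indicatorTwo * idArith) b := by
  rw [indicatorTwo_mul_apply, atQuot, evenRes]
  split_ifs
  · rw [Finset.card_image_of_injective _ (fun v w h => by simpa using h)]; simp [idArith]; omega
  · simp

theorem card_oddRes (b : ℕ) : ((oddRes b).card : ℤ) = (indicatorTwo * idArith) b := by
  rw [indicatorTwo_mul_apply, atQuot, oddRes]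
  split_ifs
  · rw [Finset.card_image_of_injective _ (fun v w h => by simpa using h)]; simp [idArith]; omega
  · simp

theorem two_mul_indicatorTwo_mul_idArith (b : ℕ) :
    (2 * (indicatorTwo * idArith) b : ℤ) = if 2 ∣ b then (b : ℤ) else 0 := by
  rw [indicatorTwo_mul_apply, atQuot]
  split_ifs with h
  · simp [idArith]; omega
  · simp

theorem arith_two_mul_apply (f : ArithmeticFunction ℤ) (n : ℕ) : (2 * f) n = 2 * f n := by
  rw [two_mul, two_mul, ArithmeticFunction.add_apply]

theorem arith_sub_apply (f g : ArithmeticFunction ℤ) (n : ℕ) : (f - g) n = f n - g n := by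
  rw [sub_eq_add_neg, sub_eq_add_neg]
  rfl

/-- The value is b for odd b; for even b the correction 2 (b/2) cancels it. -/
theorem card_evenRep (b : ℕ) :
    ((evenRep b).card : ℤ) = (idArith - 2 * (indicatorTwo * idArith)) b := by
  rw [arith_sub_apply, arith_two_mul_apply, two_mul_indicatorTwo_mul_idArith, evenRep]
  split_ifs
  · simp [idArith]
  · rw [Finset.card_image_of_injective _ (fun v w h => by simpa using h)]; simp [idArith]

theorem card_shiftPairs (a : ℕ) :
    ((shiftPairs a).card : ℤ) = (idArith - 2 * (indicatorTwo * idArith)) a := by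
  rw [arith_sub_apply, arith_two_mul_apply, two_mul_indicatorTwo_mul_idArith, shiftPairs]
  split_ifs
  · simp [idArith]
  · rw [Finset.card_image_of_injective _ (fun v w h => congrArg Prod.fst h)]; simp [idArith]

/-- The factor `a` accounts for the other, free entry of the pair (s, t). -/
theorem card_halfSet_mul (a : ℕ) :
    ((halfSet a).card : ℤ) * a = (2 * (indicatorTwo * idArith)) a := by
  rw [arith_two_mul_apply, two_mul_indicatorTwo_mul_idArith, halfSet]
  split_ifs <;> simp

theorem card_evenInd {c : ℕ} (hc : 0 < c) :
    ((evenInd c).card : ℤ) = (indicatorTwo * oneArith) c := by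
  rw [indicatorTwo_mul_apply, atQuot, evenInd]
  split_ifs with h
  · have : ¬ c < 2 := by have := Nat.le_of_dvd hc h; omega
    simp [oneArith, this]
  · simp

theorem card_oddInd {c : ℕ} (hc : 0 < c) :
    ((oddInd c).card : ℤ) = (oneArith - indicatorTwo * oneArith) c := by
  rw [arith_sub_apply, ← card_evenInd hc, evenInd, oddInd]
  split_ifs with h <;> simp [oneArith, hc.ne']

end ParameterSets

/-! ### Families of subgroups and their sizes. -/

namespace B4Model

/-- The subgroups with an echelon basis whose parameters lie in prescribed sets. -/
def basisFamily (A : ℕ → Finset (ℤ × ℤ)) (B : ℕ → Finset ℤ) (C : ℕ → Finset Unit) (n : ℕ) :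
    Set (Subgroup B4Model) :=
  {D | ∃ (a b c : ℕ) (s t u : ℤ), a * b * c = n ∧ (s, t) ∈ A a ∧ u ∈ B b ∧ () ∈ C c ∧
    HasBasis D a b c s t u}

/-- The parameter sets consist of pairwise inequivalent parameters of echelon bases. -/
structure IsAdmissible (A : ℕ → Finset (ℤ × ℤ)) (B : ℕ → Finset ℤ) (C : ℕ → Finset Unit) :
    Prop where
  eq_of_mem_fst : ∀ {a : ℕ} {s t s' t' : ℤ}, (s, t) ∈ A a → (s', t') ∈ A a →
    (a : ℤ) ∣ s - s' → (a : ℤ) ∣ t - t' → s = s' ∧ t = t'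
  eq_of_mem_snd : ∀ {b : ℕ} {u u' : ℤ}, u ∈ B b → u' ∈ B b → (b : ℤ) ∣ u - u' → u = u'
  hasBasis : ∀ {a b c : ℕ} {s t u : ℤ}, 0 < a → 0 < b → 0 < c → (s, t) ∈ A a → u ∈ B b →
    () ∈ C c → HasBasis (Subgroup.closure {⟨a, 0, 0⟩, ⟨s, b, 0⟩, ⟨t, u, c⟩}) a b c s t u

/-- The subgroups biject with their parameters. Indexing these by n = m c and then m = a b makes the
cardinality an iterated convolution. -/
theorem basisFamily_card {A : ℕ → Finset (ℤ × ℤ)} {B : ℕ → Finset ℤ} {C : ℕ → Finset Unit}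
    (h : IsAdmissible A B C) {fA fB fC : ArithmeticFunction ℤ}
    (hA : ∀ a, 0 < a → ((A a).card : ℤ) = fA a) (hB : ∀ b, 0 < b → ((B b).card : ℤ) = fB b)
    (hC : ∀ c, 0 < c → ((C c).card : ℤ) = fC c) {n : ℕ} (hn : 0 < n) :
    (basisFamily A B C n).Finite ∧
      ((basisFamily A B C n).ncard : ℤ) = (fA * fB * fC) n := by
  let P : Finset (Σ _ : ℕ × ℕ, (Σ _ : ℕ × ℕ, (ℤ × ℤ) × ℤ) × Unit) :=
    n.divisorsAntidiagonal.sigma fun p =>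
      (p.1.divisorsAntidiagonal.sigma fun q => A q.1 ×ˢ B q.2) ×ˢ C p.2
  let Φ : (Σ _ : ℕ × ℕ, (Σ _ : ℕ × ℕ, (ℤ × ℤ) × ℤ) × Unit) → Subgroup B4Model := fun d =>
    Subgroup.closure {⟨d.2.1.1.1, 0, 0⟩, ⟨d.2.1.2.1.1, d.2.1.1.2, 0⟩,
      ⟨d.2.1.2.1.2, d.2.1.2.2, d.1.2⟩}
  have hP : ∀ {m c a b : ℕ} {s t u : ℤ}, (⟨(m, c), ⟨(a, b), ((s, t), u)⟩, ()⟩ :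
      Σ _ : ℕ × ℕ, (Σ _ : ℕ × ℕ, (ℤ × ℤ) × ℤ) × Unit) ∈ P ↔
      a * b = m ∧ m * c = n ∧ (s, t) ∈ A a ∧ u ∈ B b ∧ () ∈ C c := by
    intro m c a b s t u
    simp only [P, Finset.mem_sigma, Finset.mem_product, Nat.mem_divisorsAntidiagonal]
    constructor
    · rintro ⟨⟨h1, -⟩, ⟨⟨h2, -⟩, h3, h4⟩, h5⟩
      exact ⟨h2, h1, h3, h4, h5⟩
    · rintro ⟨h1, h2, h3, h4, h5⟩
      refine ⟨⟨h2, hn.ne'⟩, ⟨⟨h1, ?_⟩, h3, h4⟩, h5⟩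
      rintro rfl
      simp at h2; omega
  have hbasis : ∀ {m c a b : ℕ} {s t u : ℤ}, (⟨(m, c), ⟨(a, b), ((s, t), u)⟩, ()⟩ :
      Σ _ : ℕ × ℕ, (Σ _ : ℕ × ℕ, (ℤ × ℤ) × ℤ) × Unit) ∈ P →
      HasBasis (Φ ⟨(m, c), ⟨(a, b), ((s, t), u)⟩, ()⟩) a b c s t u := by
    intro m c a b s t u hd
    obtain ⟨rfl, h2, h3, h4, h5⟩ := hP.1 hd
    have h0 : a * b * c ≠ 0 := by omega
    exact h.hasBasis (Nat.pos_of_ne_zero (left_ne_zero_of_mul (left_ne_zero_of_mul h0)))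
      (Nat.pos_of_ne_zero (right_ne_zero_of_mul (left_ne_zero_of_mul h0)))
      (Nat.pos_of_ne_zero (right_ne_zero_of_mul h0)) h3 h4 h5
  have himage : basisFamily A B C n = Φ '' P := by
    ext D
    constructor
    · rintro ⟨a, b, c, s, t, u, h1, h2, h3, h4, h5⟩
      refine ⟨⟨(a * b, c), ⟨(a, b), ((s, t), u)⟩, ()⟩, hP.2 ⟨rfl, h1, h2, h3, h4⟩, ?_⟩
      exact h5.eq_closure.symm
    · rintro ⟨⟨⟨m, c⟩, ⟨⟨a, b⟩, ⟨s, t⟩, u⟩, ⟨⟩⟩, hd, rfl⟩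
      obtain ⟨h1, h2, h3, h4, h5⟩ := hP.1 hd
      exact ⟨a, b, c, s, t, u, by rw [h1, h2], h3, h4, h5, hbasis hd⟩
  -- Uniqueness gives congruences, which admissibility turns into equalities; `u` comes first since
  -- `t` is comparable only afterwards.
  have hinj : Set.InjOn Φ P := by
    rintro ⟨⟨m, c⟩, ⟨⟨a, b⟩, ⟨s, t⟩, u⟩, ⟨⟩⟩ hd ⟨⟨m', c'⟩, ⟨⟨a', b'⟩, ⟨s', t'⟩, u'⟩, ⟨⟩⟩ hd' he
    have h' := hbasis hd'
    rw [← he] at h'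
    obtain ⟨rfl, rfl, rfl, hs, hu, ht⟩ := (hbasis hd).unique h'
    obtain ⟨h1, h2, h3, h4, h5⟩ := hP.1 hd
    obtain ⟨h1', h2', h3', h4', h5'⟩ := hP.1 hd'
    obtain rfl := h.eq_of_mem_snd h4 h4' hu
    obtain ⟨rfl, rfl⟩ := h.eq_of_mem_fst h3 h3' hs (ht rfl)
    rw [← h1, ← h1']
  refine ⟨himage ▸ P.finite_toSet.image Φ, ?_⟩
  rw [himage, hinj.ncard_image, Set.ncard_coe_finset, Finset.card_sigma,
    ArithmeticFunction.mul_apply, Nat.cast_sum]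
  refine Finset.sum_congr rfl fun p hp => ?_
  obtain ⟨rfl, h0⟩ := Nat.mem_divisorsAntidiagonal.1 hp
  rw [Finset.card_product, Finset.card_sigma, ArithmeticFunction.mul_apply, Nat.cast_mul,
    hC _ (Nat.pos_of_ne_zero (right_ne_zero_of_mul h0)), Nat.cast_sum]
  congr 1
  refine Finset.sum_congr rfl fun q hq => ?_
  obtain ⟨hq1, hq0⟩ := Nat.mem_divisorsAntidiagonal.1 hq
  rw [← hq1] at hq0
  rw [Finset.card_product, Nat.cast_mul, hA _ (Nat.pos_of_ne_zero (left_ne_zero_of_mul hq0)),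
    hB _ (Nat.pos_of_ne_zero (right_ne_zero_of_mul hq0))]

theorem eq_of_dvd_sub {a s s' : ℤ} (h0 : 0 ≤ s) (h1 : s < a) (h0' : 0 ≤ s') (h1' : s' < a)
    (h : a ∣ s - s') : s = s' := by
  have := Int.eq_zero_of_abs_lt_dvd h (by rw [abs_lt]; constructor <;> omega)
  omega

theorem eq_of_dvd_sub_of_even {b u u' : ℤ} (hb : b % 2 = 1) (hu : u % 2 = 0) (hu' : u' % 2 = 0)
    (h0 : 0 ≤ u) (h1 : u < 2 * b) (h0' : 0 ≤ u') (h1' : u' < 2 * b) (h : b ∣ u - u') :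
    u = u' := by
  refine eq_of_dvd_sub h0 h1 h0' h1' ((IsCoprime.mul_dvd ?_ (by omega) h))
  -- Bézout for 2 and odd b: b - 2 (b/2) = 1. Thus 2b divides the even difference.
  exact ⟨-(b / 2), 1, by omega⟩

/-- Pairs of residues modulo `a`. -/
noncomputable def boxPairs (a : ℕ) : Finset (ℤ × ℤ) := Finset.Ico (0 : ℤ) a ×ˢ Finset.Ico (0 : ℤ) a

theorem mem_boxPairs {a : ℕ} {s t : ℤ} :
    (s, t) ∈ boxPairs a ↔ (0 ≤ s ∧ s < a) ∧ 0 ≤ t ∧ t < a := by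
  simp [boxPairs]

theorem card_boxPairs (a : ℕ) : ((boxPairs a).card : ℤ) = sqArith a := by
  simp [boxPairs, sqArith, pow_two]

/-- The subgroups isomorphic to `ℤ³`. -/
abbrev familyG1 := basisFamily boxPairs evenRes evenInd

/-- The subgroups isomorphic to `π₁(𝒢₂)`. -/
abbrev familyG2 := basisFamily boxPairs evenRes oddInd

/-- The subgroups isomorphic to `π₁(ℬ₁)` with `b` even. -/
abbrev familyB1Even :=
  basisFamily (fun a => {0} ×ˢ Finset.Ico (0 : ℤ) a) oddRes (fun _ => {()})

/-- The subgroups isomorphic to `π₁(ℬ₂)` with `b` even. -/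
abbrev familyB2Even :=
  basisFamily (fun a => halfSet a ×ˢ Finset.Ico (0 : ℤ) a) oddRes (fun _ => {()})

/-- The subgroups isomorphic to `π₁(ℬ₁)` with `b` odd. -/
abbrev familyB1Odd :=
  basisFamily (fun a => Finset.Ico (0 : ℤ) a ×ˢ {0}) evenRep evenInd

/-- The subgroups isomorphic to `π₁(ℬ₂)` with `b` odd. -/
abbrev familyB2Odd :=
  basisFamily (fun a => Finset.Ico (0 : ℤ) a ×ˢ halfSet a) evenRep evenInd

/-- The subgroups isomorphic to `π₁(ℬ₄)`. -/
abbrev familyB4 := basisFamily shiftPairs evenRep oddInd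

theorem isAdmissible_G1 : IsAdmissible boxPairs evenRes evenInd where
  eq_of_mem_fst h h' h1 h2 := by
    rw [mem_boxPairs] at h h'
    exact ⟨eq_of_dvd_sub h.1.1 h.1.2 h'.1.1 h'.1.2 h1, eq_of_dvd_sub h.2.1 h.2.2 h'.2.1 h'.2.2 h2⟩
  eq_of_mem_snd h h' h1 := by
    rw [mem_evenRes] at h h'
    exact eq_of_dvd_sub h.2.2.1 h.2.2.2 h'.2.2.1 h'.2.2.2 h1
  hasBasis ha hb hc h1 h2 h3 := by
    rw [mem_evenRes] at h2
    rw [mem_evenInd] at h3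
    refine hasBasis_closure ha hb hc 0 (Or.inl ?_)
    ext <;> simp [mul_def, zsgn, h2, h3, emod_two_add] <;> ring

theorem isAdmissible_G2 : IsAdmissible boxPairs evenRes oddInd where
  eq_of_mem_fst := isAdmissible_G1.eq_of_mem_fst
  eq_of_mem_snd := isAdmissible_G1.eq_of_mem_snd
  hasBasis ha hb hc h1 h2 h3 := by
    rw [mem_evenRes] at h2
    rw [mem_oddInd] at h3
    refine hasBasis_closure ha hb hc 0 (Or.inr ?_)
    ext <;> simp [mul_def, inv_def, zsgn, h2, h3, emod_two_add] <;> ring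

theorem isAdmissible_B1Even :
    IsAdmissible (fun a => {0} ×ˢ Finset.Ico (0 : ℤ) a) oddRes (fun _ => {()}) where
  eq_of_mem_fst h h' h1 h2 := by
    simp only [Finset.mem_product, Finset.mem_singleton, Finset.mem_Ico] at h h'
    exact ⟨h.1.trans h'.1.symm, eq_of_dvd_sub h.2.1 h.2.2 h'.2.1 h'.2.2 h2⟩
  eq_of_mem_snd h h' h1 := by
    rw [mem_oddRes] at h h'
    exact eq_of_dvd_sub h.2.2.1 h.2.2.2 h'.2.2.1 h'.2.2.2 h1
  hasBasis {a b c s t u} ha hb hc h1 h2 h3 := by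
    rw [mem_oddRes] at h2
    simp only [Finset.mem_product, Finset.mem_singleton] at h1
    refine hasBasis_closure ha hb hc 0 ?_
    rcases Int.emod_two_eq_zero_or_one (c : ℤ) with h3 | h3
    · left
      ext <;> simp [mul_def, zsgn, h1.1, h2, h3, emod_two_add] <;> ring
    · right
      ext <;> simp [mul_def, inv_def, zsgn, h1.1, h2, h3, emod_two_add] <;> ring

theorem isAdmissible_B2Even :
    IsAdmissible (fun a => halfSet a ×ˢ Finset.Ico (0 : ℤ) a) oddRes (fun _ => {()}) where
  eq_of_mem_fst h h' h1 h2 := by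
    simp only [Finset.mem_product, mem_halfSet, Finset.mem_Ico] at h h'
    exact ⟨by omega, eq_of_dvd_sub h.2.1 h.2.2 h'.2.1 h'.2.2 h2⟩
  eq_of_mem_snd := isAdmissible_B1Even.eq_of_mem_snd
  hasBasis {a b c s t u} ha hb hc h1 h2 h3 := by
    rw [mem_oddRes] at h2
    simp only [Finset.mem_product, mem_halfSet] at h1
    rcases Int.emod_two_eq_zero_or_one (c : ℤ) with h3 | h3
    -- Here Z Y Z⁻¹ = ⟨-s, b, 0⟩ = X⁻¹ Y, as 2s = a; for c odd it is ⟨s, -b, 0⟩ = X Y⁻¹.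
    · refine hasBasis_closure ha hb hc (-1) (Or.inl ?_)
      rw [← h1.1]
      ext <;> simp [mul_def, zsgn, h2, h3, emod_two_add] <;> ring
    · refine hasBasis_closure ha hb hc 1 (Or.inr ?_)
      rw [← h1.1]
      ext <;> simp [mul_def, inv_def, zsgn, h2, h3, emod_two_add] <;> ring

theorem isAdmissible_B1Odd :
    IsAdmissible (fun a => Finset.Ico (0 : ℤ) a ×ˢ {0}) evenRep evenInd where
  eq_of_mem_fst h h' h1 h2 := by
    simp only [Finset.mem_product, Finset.mem_singleton, Finset.mem_Ico] at h h'
    exact ⟨eq_of_dvd_sub h.1.1 h.1.2 h'.1.1 h'.1.2 h1, h.2.trans h'.2.symm⟩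
  eq_of_mem_snd h h' h1 := by
    rw [mem_evenRep] at h h'
    exact eq_of_dvd_sub_of_even h.1 h.2.1 h'.2.1 h.2.2.1 h.2.2.2 h'.2.2.1 h'.2.2.2 h1
  hasBasis {a b c s t u} ha hb hc h1 h2 h3 := by
    rw [mem_evenRep] at h2
    rw [mem_evenInd] at h3
    simp only [Finset.mem_product, Finset.mem_singleton] at h1
    refine hasBasis_closure ha hb hc 0 (Or.inl ?_)
    ext <;> simp [mul_def, zsgn, h1.2, h2, h3, emod_two_add] <;> ring

theorem isAdmissible_B2Odd :
    IsAdmissible (fun a => Finset.Ico (0 : ℤ) a ×ˢ halfSet a) evenRep evenInd where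
  eq_of_mem_fst h h' h1 h2 := by
    simp only [Finset.mem_product, mem_halfSet, Finset.mem_Ico] at h h'
    exact ⟨eq_of_dvd_sub h.1.1 h.1.2 h'.1.1 h'.1.2 h1, by omega⟩
  eq_of_mem_snd := isAdmissible_B1Odd.eq_of_mem_snd
  hasBasis {a b c s t u} ha hb hc h1 h2 h3 := by
    rw [mem_evenRep] at h2
    rw [mem_evenInd] at h3
    simp only [Finset.mem_product, mem_halfSet] at h1
    refine hasBasis_closure ha hb hc 1 (Or.inl ?_)
    rw [← h1.2]
    ext <;> simp [mul_def, zsgn, h2, h3, emod_two_add] <;> ring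

theorem isAdmissible_B4 : IsAdmissible shiftPairs evenRep oddInd where
  eq_of_mem_fst h h' h1 h2 := by
    rw [mem_shiftPairs] at h h'
    have := eq_of_dvd_sub h.1 h.2.1 h'.1 h'.2.1 h1
    exact ⟨this, by omega⟩
  eq_of_mem_snd := isAdmissible_B1Odd.eq_of_mem_snd
  hasBasis {a b c s t u} ha hb hc h1 h2 h3 := by
    rw [mem_evenRep] at h2
    rw [mem_oddInd] at h3
    rw [mem_shiftPairs] at h1
    refine hasBasis_closure ha hb hc 1 (Or.inr ?_)
    obtain ha' : (a : ℤ) = 2 * t - 2 * s + 1 := by linarith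
    rw [ha']
    ext <;> simp [mul_def, inv_def, zsgn, h2, h3, emod_two_add] <;> ring

theorem familyG1_card {n : ℕ} (hn : 0 < n) :
    (familyG1 n).Finite ∧ ((familyG1 n).ncard : ℤ) = atQuot omega n 4 := by
  obtain ⟨h1, h2⟩ := basisFamily_card isAdmissible_G1 (fun a _ => card_boxPairs a)
    (fun b _ => card_evenRes b) (fun c hc => card_evenInd hc) hn
  refine ⟨h1, h2.trans ?_⟩
  rw [omega_eq, ← indicatorTwo_sq_mul_apply, omegaArith]
  congr 1
  ring

theorem familyG2_card {n : ℕ} (hn : 0 < n) : (familyG2 n).Finite ∧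
    ((familyG2 n).ncard : ℤ) = atQuot omega n 2 - atQuot omega n 4 := by
  obtain ⟨h1, h2⟩ := basisFamily_card isAdmissible_G2 (fun a _ => card_boxPairs a)
    (fun b _ => card_evenRes b) (fun c hc => card_oddInd hc) hn
  refine ⟨h1, h2.trans ?_⟩
  rw [omega_eq, ← indicatorTwo_sq_mul_apply, ← indicatorTwo_mul_apply, ← arith_sub_apply,
    omegaArith]
  congr 1
  ring

theorem card_oneArith {c : ℕ} (hc : 0 < c) :
    ((({()} : Finset Unit).card : ℕ) : ℤ) = oneArith c := by
  simp [oneArith, hc.ne']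

theorem familyB1Even_card {n : ℕ} (hn : 0 < n) : (familyB1Even n).Finite ∧
    ((familyB1Even n).ncard : ℤ) = atQuot chi n 2 := by
  obtain ⟨h1, h2⟩ := basisFamily_card (fA := idArith) isAdmissible_B1Even
    (fun a _ => by simp [idArith])
    (fun b _ => card_oddRes b) (fun c hc => card_oneArith hc) hn
  refine ⟨h1, h2.trans ?_⟩
  rw [chi_eq, ← indicatorTwo_mul_apply, chiArith]
  congr 1
  ring

theorem familyB1Odd_card {n : ℕ} (hn : 0 < n) : (familyB1Odd n).Finite ∧
    ((familyB1Odd n).ncard : ℤ) = atQuot chi n 2 - 2 * atQuot chi n 4 := by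
  obtain ⟨h1, h2⟩ := basisFamily_card (fA := idArith) isAdmissible_B1Odd
    (fun a _ => by simp [idArith])
    (fun b _ => card_evenRep b) (fun c hc => card_evenInd hc) hn
  refine ⟨h1, h2.trans ?_⟩
  rw [chi_eq, ← indicatorTwo_mul_apply, ← indicatorTwo_sq_mul_apply, ← arith_two_mul_apply,
    ← arith_sub_apply, chiArith]
  congr 1
  ring

theorem familyB2Even_card {n : ℕ} (hn : 0 < n) : (familyB2Even n).Finite ∧
    ((familyB2Even n).ncard : ℤ) = 2 * atQuot chi n 4 := by
  obtain ⟨h1, h2⟩ := basisFamily_card isAdmissible_B2Even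
    (fun a _ => by rw [← card_halfSet_mul]; simp)
    (fun b _ => card_oddRes b) (fun c hc => card_oneArith hc) hn
  refine ⟨h1, h2.trans ?_⟩
  rw [chi_eq, ← indicatorTwo_sq_mul_apply, ← arith_two_mul_apply, chiArith]
  congr 1
  ring

theorem familyB2Odd_card {n : ℕ} (hn : 0 < n) : (familyB2Odd n).Finite ∧
    ((familyB2Odd n).ncard : ℤ) = 2 * (atQuot chi n 4 - 2 * atQuot chi n 8) := by
  obtain ⟨h1, h2⟩ := basisFamily_card isAdmissible_B2Odd
    (fun a _ => by rw [← card_halfSet_mul, mul_comm]; simp)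
    (fun b _ => card_evenRep b) (fun c hc => card_evenInd hc) hn
  refine ⟨h1, h2.trans ?_⟩
  rw [chi_eq, ← indicatorTwo_sq_mul_apply, ← indicatorTwo_cube_mul_apply, ← arith_two_mul_apply,
    ← arith_sub_apply, ← arith_two_mul_apply, chiArith]
  congr 1
  ring

theorem familyB4_card {n : ℕ} (hn : 0 < n) : (familyB4 n).Finite ∧
    ((familyB4 n).ncard : ℤ) =
      chi n - 5 * atQuot chi n 2 + 8 * atQuot chi n 4 - 4 * atQuot chi n 8 := by
  obtain ⟨h1, h2⟩ := basisFamily_card isAdmissible_B4 (fun a _ => card_shiftPairs a)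
    (fun b _ => card_evenRep b) (fun c hc => card_oddInd hc) hn
  refine ⟨h1, h2.trans ?_⟩
  -- This is (1 - 2δ)² (1 - δ) = 1 - 5δ + 8δ² - 4δ³, with coefficients written as iterated doublings
  -- to suit `arith_two_mul_apply`.
  have e : (idArith - 2 * (indicatorTwo * idArith)) * (idArith - 2 * (indicatorTwo * idArith)) *
      (oneArith - indicatorTwo * oneArith) =
      chiArith - (2 * (2 * (indicatorTwo * chiArith)) + indicatorTwo * chiArith) +
        2 * (2 * (2 * (indicatorTwo ^ 2 * chiArith))) -
        2 * (2 * (indicatorTwo ^ 3 * chiArith)) := by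
    rw [chiArith]; ring
  rw [e, chi_eq]
  simp only [arith_sub_apply, ArithmeticFunction.add_apply, arith_two_mul_apply,
    indicatorTwo_mul_apply, indicatorTwo_sq_mul_apply, indicatorTwo_cube_mul_apply]
  ring

/-! ### Exhaustion and separation of the isomorphism types. -/

/-- Every subgroup of finite index belongs to one of the seven families. -/
theorem mem_family {D : Subgroup B4Model} {n : ℕ} (hn : 0 < n) (hD : D.index = n) :
    D ∈ familyG1 n ∨ D ∈ familyG2 n ∨ (D ∈ familyB1Even n ∨ D ∈ familyB1Odd n) ∨
      (D ∈ familyB2Even n ∨ D ∈ familyB2Odd n) ∨ D ∈ familyB4 n := by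
  obtain ⟨a, b, c, s, t, u, h⟩ := exists_hasBasis D (by omega)
  have hidx : a * b * c = n := by rw [← h.index_eq, hD]
  have ha0 : (a : ℤ) ≠ 0 := by have := h.a_pos; omega
  have hb0 : (b : ℤ) ≠ 0 := by have := h.b_pos; omega
  have emod_nonneg : ∀ m : ℤ, 0 ≤ m % a := fun m => Int.emod_nonneg m ha0
  have emod_lt : ∀ m : ℤ, m % a < a := fun m =>
    Int.emod_lt_of_pos m (by have := h.a_pos; omega)
  have dvd_emod : ∀ m d : ℤ, d ∣ m % d - m := fun m d => by
    rw [dvd_sub_comm]; exact Int.dvd_self_sub_emod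
  have hu1 := Int.emod_nonneg u hb0
  have hu2 : u % b < b := Int.emod_lt_of_pos u (by have := h.b_pos; omega)
  have half : ∀ r : ℤ, 0 ≤ r → r < a → (a : ℤ) ∣ 2 * r → r = 0 ∨ 2 * r = a := by
    rintro r h0 h1 ⟨w, hw⟩
    have hw0 : 0 ≤ w := by by_contra hneg; nlinarith
    have hw2 : w < 2 := by by_contra hneg; nlinarith
    interval_cases w <;> omega
  rcases Int.emod_two_eq_zero_or_one (b : ℤ) with hb | hb
  · obtain ⟨t', h⟩ := h.change_u (dvd_emod u b)
    replace h := (h.change_s (dvd_emod s a)).change_t (dvd_emod t' a)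
    have hs1 := emod_nonneg s
    have hs2 := emod_lt s
    have ht1 := emod_nonneg t'
    have ht2 := emod_lt t'
    generalize u % (b : ℤ) = u' at *
    generalize s % (a : ℤ) = s' at *
    generalize t' % (a : ℤ) = t'' at *
    rcases Int.emod_two_eq_zero_or_one u' with hu | hu
    · rcases Int.emod_two_eq_zero_or_one (c : ℤ) with hc | hc
      · exact Or.inl ⟨a, b, c, s', t'', u', hidx, mem_boxPairs.2 ⟨⟨hs1, hs2⟩, ht1, ht2⟩,
          mem_evenRes.2 ⟨hb, hu, hu1, hu2⟩, mem_evenInd.2 hc, h⟩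
      · exact Or.inr <| Or.inl ⟨a, b, c, s', t'', u', hidx,
          mem_boxPairs.2 ⟨⟨hs1, hs2⟩, ht1, ht2⟩,
          mem_evenRes.2 ⟨hb, hu, hu1, hu2⟩, mem_oddInd.2 hc, h⟩
    · have h2s : (a : ℤ) ∣ 2 * s' := by
        rcases Int.emod_two_eq_zero_or_one (c : ℤ) with hc | hc
        · have := h.dvd_of_even hc
          simp only [zsgn, hb, hu] at this
          exact (dvd_neg.2 this).trans (dvd_of_eq (by ring))
        · have := h.dvd_of_odd hc
          simp only [zsgn, hb, hu] at this
          convert this using 1; ring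
      rcases half s' hs1 hs2 h2s with h0 | h0
      · refine Or.inr <| Or.inr <| Or.inl <| Or.inl ⟨a, b, c, s', t'', u', hidx, ?_,
          mem_oddRes.2 ⟨hb, hu, hu1, hu2⟩, Finset.mem_singleton_self _, h⟩
        simp [h0, ht1, ht2]
      · refine Or.inr <| Or.inr <| Or.inr <| Or.inl <| Or.inl ⟨a, b, c, s', t'', u', hidx, ?_,
          mem_oddRes.2 ⟨hb, hu, hu1, hu2⟩, Finset.mem_singleton_self _, h⟩
        simp [mem_halfSet, h0, ht1, ht2]
  -- For odd b, adding b flips parity, so each class modulo b has an even representative in [0, 2b).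
  · obtain ⟨u', hu, hu1, hu2, hdvd⟩ : ∃ u' : ℤ, u' % 2 = 0 ∧ 0 ≤ u' ∧ u' < 2 * b ∧
        (b : ℤ) ∣ u' - u := by
      rcases Int.emod_two_eq_zero_or_one (u % b) with hu | hu
      · exact ⟨u % b, hu, hu1, by omega, dvd_emod u b⟩
      · refine ⟨u % b + b, by omega, by omega, by omega, ?_⟩
        rw [add_sub_right_comm]
        exact dvd_add (dvd_emod u b) dvd_rfl
    obtain ⟨t', h⟩ := h.change_u hdvd
    replace h := h.change_s (dvd_emod s a)
    have hs1 := emod_nonneg s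
    have hs2 := emod_lt s
    generalize s % (a : ℤ) = s' at *
    rcases Int.emod_two_eq_zero_or_one (c : ℤ) with hc | hc
    · replace h := h.change_t (dvd_emod t' a)
      have ht1 := emod_nonneg t'
      have ht2 := emod_lt t'
      generalize t' % (a : ℤ) = t'' at *
      have h2t : (a : ℤ) ∣ 2 * t'' := by
        have := h.dvd_of_even hc
        simp only [zsgn, hb, hu] at this
        convert this using 1; ring
      rcases half t'' ht1 ht2 h2t with h0 | h0
      · refine Or.inr <| Or.inr <| Or.inl <| Or.inr ⟨a, b, c, s', t'', u', hidx, ?_,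
          mem_evenRep.2 ⟨hb, hu, hu1, hu2⟩, mem_evenInd.2 hc, h⟩
        simp [h0, hs1, hs2]
      · refine Or.inr <| Or.inr <| Or.inr <| Or.inl <| Or.inr ⟨a, b, c, s', t'', u', hidx, ?_,
          mem_evenRep.2 ⟨hb, hu, hu1, hu2⟩, mem_evenInd.2 hc, h⟩
        simp [mem_halfSet, h0, hs1, hs2]
    · obtain ⟨w, hw⟩ : (a : ℤ) ∣ 2 * (t' - s') + 1 := by
        have := h.dvd_of_odd hc
        simp only [zsgn, hb, hu] at this
        convert this using 1; ring
      -- The odd number 2(t' - s') + 1 equals a w, so a and w are odd. With w = 2v + 1, t' exceeds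
      -- s' + a/2 by exactly v a.
      have haw : (a * w : ℤ) % 2 = 1 := by omega
      have ha : (a : ℤ) % 2 = 1 := by
        rcases Int.emod_two_eq_zero_or_one (a : ℤ) with h' | h'
        · simp [Int.mul_emod, h'] at haw
        · exact h'
      have hw1 : w % 2 = 1 := by
        rcases Int.emod_two_eq_zero_or_one w with h' | h'
        · simp [Int.mul_emod, h'] at haw
        · exact h'
      obtain ⟨v, rfl⟩ : ∃ v, w = 2 * v + 1 := ⟨w / 2, by omega⟩
      have ha2 : (a : ℤ) = 2 * (a / 2) + 1 := by omega
      replace h := h.change_t (t' := s' + a / 2) ⟨-v, by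
        generalize (a : ℤ) / 2 = e at *
        rw [ha2] at hw ⊢
        linarith⟩
      refine Or.inr <| Or.inr <| Or.inr <| Or.inr ⟨a, b, c, s', _, u', hidx, ?_,
        mem_evenRep.2 ⟨hb, hu, hu1, hu2⟩, mem_oddInd.2 hc, h⟩
      rw [mem_shiftPairs]
      omega

theorem index_of_mem_basisFamily {A : ℕ → Finset (ℤ × ℤ)} {B : ℕ → Finset ℤ}
    {C : ℕ → Finset Unit} {n : ℕ} {D : Subgroup B4Model} (h : D ∈ basisFamily A B C n) :
    D.index = n := by
  obtain ⟨a, b, c, s, t, u, hn, -, -, -, hD⟩ := h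
  rw [hD.index_eq, hn]

variable {n : ℕ} {D : Subgroup B4Model}

theorem mulEquiv_of_mem_familyG1 (h : D ∈ familyG1 n) : Nonempty (D ≃* PiG1) := by
  obtain ⟨a, b, c, s, t, u, hn, h1, h2, h3, hD⟩ := h
  rw [mem_evenRes] at h2
  exact hD.mulEquiv_piG1 h2.1 (mem_evenInd.1 h3) h2.2.1

theorem mulEquiv_of_mem_familyG2 (h : D ∈ familyG2 n) : Nonempty (D ≃* PiG2) := by
  obtain ⟨a, b, c, s, t, u, hn, h1, h2, h3, hD⟩ := h
  rw [mem_evenRes] at h2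
  exact hD.mulEquiv_piG2 h2.1 (mem_oddInd.1 h3) h2.2.1

theorem mulEquiv_of_mem_familyB1 (h : D ∈ familyB1Even n ∨ D ∈ familyB1Odd n) :
    Nonempty (D ≃* PiB1) := by
  rcases h with ⟨a, b, c, s, t, u, hn, h1, h2, h3, hD⟩ | ⟨a, b, c, s, t, u, hn, h1, h2, h3, hD⟩
  · rw [mem_oddRes] at h2
    rw [Finset.mem_product, Finset.mem_singleton] at h1
    exact hD.mulEquiv_piB1_of_even h2.1 h2.2.1 h1.1
  · rw [mem_evenRep] at h2
    rw [Finset.mem_product, Finset.mem_singleton] at h1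
    exact hD.mulEquiv_piB1_of_odd h2.1 (mem_evenInd.1 h3) h2.2.1 h1.2

theorem mulEquiv_of_mem_familyB2 (h : D ∈ familyB2Even n ∨ D ∈ familyB2Odd n) :
    Nonempty (D ≃* PiB2) := by
  rcases h with ⟨a, b, c, s, t, u, hn, h1, h2, h3, hD⟩ | ⟨a, b, c, s, t, u, hn, h1, h2, h3, hD⟩
  · rw [mem_oddRes] at h2
    rw [Finset.mem_product, mem_halfSet] at h1
    exact hD.mulEquiv_piB2_of_even h2.1 h2.2.1 h1.1
  · rw [mem_evenRep] at h2
    rw [Finset.mem_product, mem_halfSet] at h1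
    exact hD.mulEquiv_piB2_of_odd h2.1 (mem_evenInd.1 h3) h2.2.1 h1.2

theorem mulEquiv_of_mem_familyB4 (h : D ∈ familyB4 n) : Nonempty (D ≃* PiB4) := by
  obtain ⟨a, b, c, s, t, u, hn, h1, h2, h3, hD⟩ := h
  rw [mem_evenRep] at h2
  rw [mem_shiftPairs] at h1
  exact hD.mulEquiv_piB4 h2.1 (mem_oddInd.1 h3) h2.2.1 h1.2.2

/-- The invariant `b` is even in one family and odd in the other. -/
theorem disjoint_of_odd_even {A A' : ℕ → Finset (ℤ × ℤ)} {C C' : ℕ → Finset Unit} :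
    Disjoint (basisFamily A oddRes C n) (basisFamily A' evenRep C' n) := by
  rw [Set.disjoint_left]
  rintro D ⟨a, b, c, s, t, u, -, -, hb, -, hD⟩ ⟨a', b', c', s', t', u', -, -, hb', -, hD'⟩
  obtain ⟨-, rfl, -⟩ := hD.unique hD'
  rw [mem_oddRes] at hb
  rw [mem_evenRep] at hb'
  omega

theorem homCount_eq {H : Type} [Group H] (h : Nonempty (D ≃* H)) : homCount D = homCount H :=
  h.elim homCount_congr

/-- The homomorphism counts separate the five isomorphism types. -/
theorem setOf_index_eq (hn : 0 < n) :
    {D : Subgroup B4Model | D.index = n ∧ Nonempty (D ≃* PiG1)} = familyG1 n ∧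
    {D : Subgroup B4Model | D.index = n ∧ Nonempty (D ≃* PiG2)} = familyG2 n ∧
    {D : Subgroup B4Model | D.index = n ∧ Nonempty (D ≃* PiB1)} =
      familyB1Even n ∪ familyB1Odd n ∧
    {D : Subgroup B4Model | D.index = n ∧ Nonempty (D ≃* PiB2)} =
      familyB2Even n ∪ familyB2Odd n ∧
    {D : Subgroup B4Model | D.index = n ∧ Nonempty (D ≃* PiB4)} = familyB4 n := by
  -- Every subgroup lies in some family, which fixes its count; as the five values differ, the count
  -- determines the family.
  have key : ∀ D : Subgroup B4Model, D.index = n →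
      (homCount D = 216 → D ∈ familyG1 n) ∧ (homCount D = 24 → D ∈ familyG2 n) ∧
      (homCount D = 72 → D ∈ familyB1Even n ∪ familyB1Odd n) ∧
      (homCount D = 36 → D ∈ familyB2Even n ∪ familyB2Odd n) ∧
      (homCount D = 12 → D ∈ familyB4 n) := by
    intro D hD
    rcases mem_family hn hD with h | h | h | h | h
    · have := (homCount_eq (mulEquiv_of_mem_familyG1 h)).trans homCount_piG1
      simp [this, h]
    · have := (homCount_eq (mulEquiv_of_mem_familyG2 h)).trans homCount_piG2
      simp [this, h]
    · have := (homCount_eq (mulEquiv_of_mem_familyB1 h)).trans homCount_piB1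
      simp [this, h]
    · have := (homCount_eq (mulEquiv_of_mem_familyB2 h)).trans homCount_piB2
      simp [this, h]
    · have := (homCount_eq (mulEquiv_of_mem_familyB4 h)).trans homCount_piB4
      simp [this, h]
  refine ⟨?_, ?_, ?_, ?_, ?_⟩ <;> ext D <;> constructor
  · rintro ⟨h1, h2⟩; exact (key D h1).1 ((homCount_eq h2).trans homCount_piG1)
  · intro h; exact ⟨index_of_mem_basisFamily h, mulEquiv_of_mem_familyG1 h⟩
  · rintro ⟨h1, h2⟩; exact (key D h1).2.1 ((homCount_eq h2).trans homCount_piG2)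
  · intro h; exact ⟨index_of_mem_basisFamily h, mulEquiv_of_mem_familyG2 h⟩
  · rintro ⟨h1, h2⟩; exact (key D h1).2.2.1 ((homCount_eq h2).trans homCount_piB1)
  · intro h
    exact ⟨h.elim index_of_mem_basisFamily index_of_mem_basisFamily, mulEquiv_of_mem_familyB1 h⟩
  · rintro ⟨h1, h2⟩; exact (key D h1).2.2.2.1 ((homCount_eq h2).trans homCount_piB2)
  · intro h
    exact ⟨h.elim index_of_mem_basisFamily index_of_mem_basisFamily, mulEquiv_of_mem_familyB2 h⟩
  · rintro ⟨h1, h2⟩; exact (key D h1).2.2.2.2 ((homCount_eq h2).trans homCount_piB4)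
  · intro h; exact ⟨index_of_mem_basisFamily h, mulEquiv_of_mem_familyB4 h⟩

theorem finite_setOf_index (hn : 0 < n) : {D : Subgroup B4Model | D.index = n}.Finite := by
  refine ((familyG1_card hn).1.union <| (familyG2_card hn).1.union <|
    ((familyB1Even_card hn).1.union (familyB1Odd_card hn).1).union <|
    ((familyB2Even_card hn).1.union (familyB2Odd_card hn).1).union
      (familyB4_card hn).1).subset ?_
  intro D hD
  exact mem_family hn hD

/-- The whole model is itself the ℬ₄ case with a = b = c = 1 and s = t = u = 0. -/
theorem nonempty_mulEquiv_piB4 : Nonempty (PiB4 ≃* B4Model) := by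
  have h : HasBasis ⊤ 1 1 1 0 0 0 := by
    constructor <;> simp
  obtain ⟨e⟩ := h.mulEquiv_piB4 rfl rfl rfl (by simp)
  exact ⟨e.symm.trans Subgroup.topEquiv⟩

end B4Model

/-! ### Transfer from the model to the presented group. -/

theorem Subgroup.index_map_mulEquiv {G G' : Type*} [Group G] [Group G'] (e : G ≃* G')
    (D : Subgroup G) : (e.mapSubgroup D).index = D.index :=
  Subgroup.index_map_equiv D e

theorem Subgroup.nonempty_mapSubgroup_mulEquiv_iff {G G' H : Type*} [Group G] [Group G'] [Group H]
    (e : G ≃* G') (D : Subgroup G) :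
    Nonempty (e.mapSubgroup D ≃* H) ↔ Nonempty (D ≃* H) :=
  ⟨fun ⟨f⟩ => ⟨(e.subgroupMap D).trans f⟩, fun ⟨f⟩ => ⟨(e.subgroupMap D).symm.trans f⟩⟩

theorem subgroupCount_congr {H G G' : Type} [Group H] [Group G] [Group G'] (e : G ≃* G') (n : ℕ) :
    subgroupCount H G n = subgroupCount H G' n := by
  rw [subgroupCount, subgroupCount, ← Set.ncard_image_of_injective _ e.mapSubgroup.injective]
  congr 1
  ext D
  obtain ⟨D, rfl⟩ := e.mapSubgroup.surjective D
  rw [e.mapSubgroup.injective.mem_set_image]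
  simp only [Set.mem_ofPred_eq, Subgroup.index_map_mulEquiv,
    Subgroup.nonempty_mapSubgroup_mulEquiv_iff]

open B4Model

theorem theorem3 :
    (∀ Δ : Subgroup PiB4, Δ.FiniteIndex →
      Nonempty (Δ ≃* PiG1) ∨ Nonempty (Δ ≃* PiG2) ∨ Nonempty (Δ ≃* PiB1) ∨
        Nonempty (Δ ≃* PiB2) ∨ Nonempty (Δ ≃* PiB4)) ∧
    ∀ n : ℕ, 0 < n →
      {Δ : Subgroup PiB4 | Δ.index = n}.Finite ∧
      (subgroupCount PiG1 PiB4 n : ℤ) = atQuot omega n 4 ∧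
      (subgroupCount PiG2 PiB4 n : ℤ) = atQuot omega n 2 - atQuot omega n 4 ∧
      (subgroupCount PiB1 PiB4 n : ℤ) = 2 * atQuot chi n 2 - 2 * atQuot chi n 4 ∧
      (subgroupCount PiB2 PiB4 n : ℤ) = 4 * atQuot chi n 4 - 4 * atQuot chi n 8 ∧
      (subgroupCount PiB4 PiB4 n : ℤ) =
        chi n - 5 * atQuot chi n 2 + 8 * atQuot chi n 4 - 4 * atQuot chi n 8 := by
  obtain ⟨e⟩ := nonempty_mulEquiv_piB4
  constructor
  · intro Δ hΔ
    simp only [← Subgroup.nonempty_mapSubgroup_mulEquiv_iff e Δ]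
    rcases mem_family (Nat.pos_of_ne_zero hΔ.index_ne_zero)
      (Subgroup.index_map_mulEquiv e Δ) with h | h | h | h | h
    · exact Or.inl (mulEquiv_of_mem_familyG1 h)
    · exact Or.inr <| Or.inl (mulEquiv_of_mem_familyG2 h)
    · exact Or.inr <| Or.inr <| Or.inl (mulEquiv_of_mem_familyB1 h)
    · exact Or.inr <| Or.inr <| Or.inr <| Or.inl (mulEquiv_of_mem_familyB2 h)
    · exact Or.inr <| Or.inr <| Or.inr <| Or.inr (mulEquiv_of_mem_familyB4 h)
  · intro n hn
    obtain ⟨h1, h2, h3, h4, h5⟩ := setOf_index_eq hn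
    have key {H : Type} [Group H] {S : Set (Subgroup B4Model)}
        (h : {D : Subgroup B4Model | D.index = n ∧ Nonempty (D ≃* H)} = S) :
        subgroupCount H PiB4 n = S.ncard := by
      rw [subgroupCount_congr e, subgroupCount, h]
    refine ⟨?_, ?_, ?_, ?_, ?_, ?_⟩
    · refine ((finite_setOf_index hn).preimage (f := e.mapSubgroup)
        e.mapSubgroup.injective.injOn).subset ?_
      intro Δ hΔ
      exact (Subgroup.index_map_mulEquiv e Δ).trans hΔ
    · rw [key h1, (familyG1_card hn).2]
    · rw [key h2, (familyG2_card hn).2]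
    · rw [key h3, Set.ncard_union_eq disjoint_of_odd_even (familyB1Even_card hn).1
        (familyB1Odd_card hn).1, Nat.cast_add, (familyB1Even_card hn).2, (familyB1Odd_card hn).2]
      ring
    · rw [key h4, Set.ncard_union_eq disjoint_of_odd_even (familyB2Even_card hn).1
        (familyB2Odd_card hn).1, Nat.cast_add, (familyB2Even_card hn).2, (familyB2Odd_card hn).2]
      ring
    · rw [key h5, (familyB4_card hn).2]
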